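/- Let $Cl_{p,q}$ be the universal Clifford algebra of $\mathbb{R}^{p+q}$ with generators $e_1,\dots,e_{p+q}$, $e_i^2=\varepsilon_i$, $\varepsilon_i=1$ for $i\le p$ and $\varepsilon_i=-1$ for $i>p$, $e_ie_j=-e_je_i$ for $i\ne j$. Assume $p+q\le 9$ and $p-q\not\equiv 1 \pmod 4$. Let $T_\varepsilon$ be the linear anti-automorphism of $Cl_{p,q}$ with $T_\varepsilon(e_i)=\varepsilon_i e_i=e_i^{-1}$, let $e_A=e_{i_1}\cdots e_{i_s}$ for $A=\{i_1<\dots<i_s\}$ be the basis monomials, and let $G_{p,q}=\{\pm e_A\}$ be the Salingaros vee group. Put $k=q-r_{q-p}$, where $r_i$ are the Radon–Hurwitz numbers ($r_0,\dots,r_7=0,1,2,2,3,3,3,3$ and $r_{i+8}=r_i+4$ for $i\in\mathbb{Z}$). Let $f=\tfrac12(1\pm e_{A_1})\cdots\tfrac12(1\pm e_{A_k})$ with any choice of signs, where $e_{A_1},\dots,e_{A_k}$ are commuting basis monomials with square $1$ that generate a group of order $2^k$ not containing $-1$. Let $S=Cl_{p,q}f$, regarded as a right module over $\mathbb{K}=f\,Cl_{p,q}f$,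 let $G_{p,q}(f)$ be the stabilizer of $f$ under conjugation by $G_{p,q}$, and let $m_1,\dots,m_N\in G_{p,q}$ be a left transversal of $G_{p,q}(f)$ in $G_{p,q}$, that is, a system of representatives of the left cosets, each occurring exactly once. Then $N=2^k$ and $[m_1f,\dots,m_Nf]$ is a basis of $S$ over $\mathbb{K}$. For $u\in Cl_{p,q}$ let $[u]\in \mathrm{Mat}(N,\mathbb{K})$ be the matrix in this basis of the spinor representation $\psi\mapsto u\psi$, so $u\,m_jf=\sum_i m_if\,[u]_{ij}$. Then: 1. if $p-q\equiv 0,1,2 \pmod 8$, then $\mathbb{K}\cong\mathbb{R}$ and $[T_\varepsilon(u)]=[u]^{T}$ for all $u\in Cl_{p,q}$; 2. if $p-q\equiv 3,7 \pmod 8$, then $\mathbb{K}\cong\mathbb{C}$ as real algebras and, under every real algebra isomorphism $\mathbb{K}\cong\mathbb{C}$, $[T_\varepsilon(u)]$ is the complex Hermitian conjugate (conjugate transpose) of $[u]$ for all $u\in Cl_{p,q}$; 3. if $p-q\equiv 4,5,6 \pmod 8$, then $\mathbb{K}\cong\mathbb{H}$ as real algebras and, under every real algebra isomorphism $\mathbb{K}\cong\mathbb{H}$,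 $[T_\varepsilon(u)]$ is the quaternionic Hermitian conjugate (quaternion-conjugate transpose) of $[u]$ for all $u\in Cl_{p,q}$. -/

import Mathlib

noncomputable section

open scoped Matrix

namespace CliffordSpinor

/-! ### The real Clifford algebra of signature `(p, q)` -/

/-- The weights `ε_i`: the first `p` are `+1`, the last `q` are `-1`. -/
def weight (p q : ℕ) (i : Fin (p + q)) : ℝ := if (i : ℕ) < p then 1 else -1

/-- The quadratic form `x_1² + ⋯ + x_p² - x_{p+1}² - ⋯ - x_{p+q}²` on `ℝ^{p+q}`. -/
def form (p q : ℕ) : QuadraticForm ℝ (Fin (p + q) → ℝ) :=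
  QuadraticMap.weightedSumSquares ℝ (weight p q)

/-- The universal Clifford algebra `Cl_{p,q}`. -/
abbrev Cl (p q : ℕ) : Type := CliffordAlgebra (form p q)

/-- The generator `e_i`. -/
def gen (p q : ℕ) (i : Fin (p + q)) : Cl p q :=
  CliffordAlgebra.ι (form p q) (Pi.single i 1)

theorem weight_mul_self (p q : ℕ) (i : Fin (p + q)) : weight p q i * weight p q i = 1 := by
  unfold weight; split_ifs <;> norm_num

theorem form_single (p q : ℕ) (i : Fin (p + q)) (c : ℝ) :
    form p q (Pi.single i c) = weight p q i * (c * c) := by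
  rw [form, QuadraticMap.weightedSumSquares_apply, Finset.sum_eq_single i]
  · simp
  · intro j _ hj; simp [Pi.single_eq_of_ne hj]
  · simp

theorem gen_mul_self (p q : ℕ) (i : Fin (p + q)) :
    gen p q i * gen p q i = algebraMap ℝ (Cl p q) (weight p q i) := by
  rw [gen, CliffordAlgebra.ι_sq_scalar, form_single]; simp

theorem gen_mul_gen (p q : ℕ) {i j : Fin (p + q)} (h : i ≠ j) :
    gen p q i * gen p q j = -(gen p q j * gen p q i) := by
  refine CliffordAlgebra.ι_mul_ι_comm_of_isOrtho ?_
  rw [QuadraticMap.isOrtho_def]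
  simp only [form, QuadraticMap.weightedSumSquares_apply, ← Finset.sum_add_distrib]
  refine Finset.sum_congr rfl fun k _ => ?_
  by_cases hi : k = i
  · subst hi; simp [Pi.single_eq_of_ne h]
  · simp [Pi.single_eq_of_ne hi]

/-! ### The transposition anti-involution -/

/-- The orthogonal map `t_ε`, `e_i ↦ ε_i e_i`. -/
def signIsometry (p q : ℕ) : form p q →qᵢ form p q where
  toLinearMap := LinearMap.pi fun i => weight p q i • LinearMap.proj i
  map_app' v := by
    simp only [form, QuadraticMap.weightedSumSquares_apply]
    refine Finset.sum_congr rfl fun i _ => ?_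
    have := weight_mul_self p q i
    simp only [AddHom.toFun_eq_coe, LinearMap.coe_toAddHom, LinearMap.pi_apply,
      LinearMap.smul_apply, LinearMap.proj_apply, smul_eq_mul]
    linear_combination weight p q i * (v i * v i) * this

/-- The transposition anti-involution `T_ε` of `Cl_{p,q}`: the linear anti-automorphism
extending `e_i ↦ ε_i e_i = e_i⁻¹`. -/
def transposition (p q : ℕ) : Cl p q →ₗ[ℝ] Cl p q :=
  CliffordAlgebra.reverse ∘ₗ (CliffordAlgebra.map (signIsometry p q)).toLinearMap

theorem transposition_gen (p q : ℕ) (i : Fin (p + q)) :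
    transposition p q (gen p q i) = weight p q i • gen p q i := by
  have h : signIsometry p q (Pi.single i 1) = weight p q i • Pi.single i (1 : ℝ) := by
    funext j
    change weight p q j * (Pi.single i (1 : ℝ) : Fin (p + q) → ℝ) j = _
    by_cases hj : j = i
    · subst hj; simp
    · simp [Pi.single_eq_of_ne hj]
  simp only [transposition, gen, LinearMap.comp_apply, AlgHom.toLinearMap_apply,
    CliffordAlgebra.map_apply_ι, h, map_smul, CliffordAlgebra.reverse_ι]

theorem transposition_one (p q : ℕ) : transposition p q 1 = 1 := by
  simp [transposition]

theorem transposition_mul (p q : ℕ) (u v : Cl p q) :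
    transposition p q (u * v) = transposition p q v * transposition p q u := by
  simp [transposition]

/-! ### Basis monomials and the Salingaros vee group -/

/-- The generator `e_i` as an invertible element, with inverse `ε_i e_i`. -/
def genUnit (p q : ℕ) (i : Fin (p + q)) : (Cl p q)ˣ where
  val := gen p q i
  inv := weight p q i • gen p q i
  val_inv := by
    rw [mul_smul_comm, gen_mul_self, Algebra.smul_def, ← map_mul, weight_mul_self, map_one]
  inv_val := by
    rw [smul_mul_assoc, gen_mul_self, Algebra.smul_def, ← map_mul, weight_mul_self, map_one]

/-- The Grassmann basis monomial `e_{i_1} ⋯ e_{i_s}`, where `A = {i_1 < ⋯ < i_s}`. -/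
def monomial (p q : ℕ) (A : Finset (Fin (p + q))) : (Cl p q)ˣ :=
  (A.sort.map (genUnit p q)).prod

theorem genUnit_mul_self (p q : ℕ) (i : Fin (p + q)) :
    genUnit p q i * genUnit p q i = 1 ∨ genUnit p q i * genUnit p q i = -1 := by
  have h := gen_mul_self p q i
  unfold weight at h
  split_ifs at h
  · left; ext; change gen p q i * gen p q i = 1; simpa using h
  · right; ext; change gen p q i * gen p q i = -1; simpa using h

theorem genUnit_mul_comm (p q : ℕ) {i j : Fin (p + q)} (h : i ≠ j) :
    genUnit p q i * genUnit p q j = -(genUnit p q j * genUnit p q i) := by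
  ext; exact gen_mul_gen p q h

theorem genUnit_mul_sorted (p q : ℕ) (i : Fin (p + q)) (l : List (Fin (p + q)))
    (hl : l.Pairwise (· < ·)) :
    ∃ l' : List (Fin (p + q)), l'.Pairwise (· < ·) ∧ (∀ x ∈ l', x = i ∨ x ∈ l) ∧
      (genUnit p q i * (l.map (genUnit p q)).prod = (l'.map (genUnit p q)).prod ∨
        genUnit p q i * (l.map (genUnit p q)).prod = -(l'.map (genUnit p q)).prod) := by
  induction l with
  | nil => exact ⟨[i], by simp, by simp, by simp⟩
  | cons a t ih =>
    rw [List.pairwise_cons] at hl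
    rcases lt_trichotomy i a with h | h | h
    · refine ⟨i :: a :: t, ?_, by simp, by simp⟩
      refine List.pairwise_cons.2 ⟨?_, List.pairwise_cons.2 hl⟩
      intro x hx
      rcases List.mem_cons.1 hx with rfl | hx
      · exact h
      · exact h.trans (hl.1 x hx)
    · subst h
      refine ⟨t, hl.2, fun x hx => Or.inr (List.mem_cons_of_mem _ hx), ?_⟩
      rw [List.map_cons, List.prod_cons, ← mul_assoc]
      rcases genUnit_mul_self p q i with h | h <;> simp [h]
    · obtain ⟨l', h1, h2, h3⟩ := ih hl.2
      refine ⟨a :: l', List.pairwise_cons.2 ⟨?_, h1⟩, ?_, ?_⟩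
      · intro x hx
        rcases h2 x hx with rfl | hx
        · exact h
        · exact hl.1 x hx
      · intro x hx
        rcases List.mem_cons.1 hx with rfl | hx
        · simp
        · rcases h2 x hx with rfl | hx <;> simp [*]
      · rw [List.map_cons, List.prod_cons, ← mul_assoc, genUnit_mul_comm p q h.ne',
          List.map_cons, List.prod_cons, neg_mul, mul_assoc]
        rcases h3 with h3 | h3 <;> simp [h3]

theorem genUnit_mul_monomial (p q : ℕ) (i : Fin (p + q)) (A : Finset (Fin (p + q))) :
    ∃ B, genUnit p q i * monomial p q A = monomial p q B ∨
      genUnit p q i * monomial p q A = -monomial p q B := by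
  obtain ⟨l', h1, -, h3⟩ := genUnit_mul_sorted p q i A.sort A.sortedLT_sort.pairwise
  refine ⟨l'.toFinset, ?_⟩
  have h4 : l'.toFinset.sort = l' :=
    (List.toFinset_sort (· ≤ ·) (h1.imp fun h => h.ne)).2 (h1.imp fun h => h.le)
  simpa only [monomial, h4] using h3

theorem genUnit_list_mul_monomial (p q : ℕ) (l : List (Fin (p + q))) (A : Finset (Fin (p + q))) :
    ∃ B, (l.map (genUnit p q)).prod * monomial p q A = monomial p q B ∨
      (l.map (genUnit p q)).prod * monomial p q A = -monomial p q B := by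
  induction l with
  | nil => exact ⟨A, by simp⟩
  | cons a t ih =>
    obtain ⟨B, hB⟩ := ih
    obtain ⟨C, hC⟩ := genUnit_mul_monomial p q a B
    refine ⟨C, ?_⟩
    rw [List.map_cons, List.prod_cons, mul_assoc]
    rcases hB with hB | hB <;> rcases hC with hC | hC <;> simp [hB, hC]

theorem inv_genUnit_list (p q : ℕ) (l : List (Fin (p + q))) :
    (l.map (genUnit p q)).prod⁻¹ = (l.reverse.map (genUnit p q)).prod ∨
      (l.map (genUnit p q)).prod⁻¹ = -(l.reverse.map (genUnit p q)).prod := by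
  induction l with
  | nil => simp
  | cons a t ih =>
    have ha : (genUnit p q a)⁻¹ = genUnit p q a ∨ (genUnit p q a)⁻¹ = -genUnit p q a := by
      rcases genUnit_mul_self p q a with h | h
      · exact Or.inl (inv_eq_of_mul_eq_one_right h)
      · exact Or.inr (inv_eq_of_mul_eq_one_right (by rw [mul_neg, h, neg_neg]))
    rw [List.map_cons, List.prod_cons, mul_inv_rev, List.reverse_cons, List.map_append,
      List.prod_append]
    rcases ih with ih | ih <;> rcases ha with ha | ha <;> simp [ih, ha]

/-- The Salingaros vee group `G_{p,q} = {± e_A}`, with the Clifford product. -/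
def veeGroup (p q : ℕ) : Subgroup (Cl p q)ˣ where
  carrier := {g | ∃ A, g = monomial p q A ∨ g = -monomial p q A}
  one_mem' := ⟨∅, Or.inl (by simp [monomial])⟩
  mul_mem' := by
    rintro _ _ ⟨A, hA⟩ ⟨B, hB⟩
    obtain ⟨C, hC⟩ := genUnit_list_mul_monomial p q A.sort B
    refine ⟨C, ?_⟩
    change monomial p q A * monomial p q B = _ ∨ monomial p q A * monomial p q B = _ at hC
    rcases hA with rfl | rfl <;> rcases hB with rfl | rfl <;> rcases hC with hC | hC <;>
      simp [hC]
  inv_mem' := by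
    rintro _ ⟨A, hA⟩
    obtain ⟨C, hC⟩ := genUnit_list_mul_monomial p q A.sort.reverse ∅
    have h0 : monomial p q ∅ = 1 := by simp [monomial]
    rw [h0, mul_one] at hC
    have hi := inv_genUnit_list p q A.sort
    change (monomial p q A)⁻¹ = _ ∨ (monomial p q A)⁻¹ = _ at hi
    have hinv : (monomial p q A)⁻¹ = monomial p q C ∨ (monomial p q A)⁻¹ = -monomial p q C := by
      rcases hi with hi | hi <;> rcases hC with hC | hC <;> rw [hi, hC] <;> simp
    refine ⟨C, ?_⟩
    rcases hA with rfl | rfl <;> rcases hinv with h | h <;> simp [inv_neg, h]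

/-- The stabilizer `G_{p,q}(f)` of `f` under conjugation by elements of `G_{p,q}`. -/
def stabilizer (p q : ℕ) (f : Cl p q) : Subgroup (veeGroup p q) where
  carrier := {g | ((g : (Cl p q)ˣ) : Cl p q) * f * ((g : (Cl p q)ˣ)⁻¹ : (Cl p q)ˣ) = f}
  one_mem' := by simp
  mul_mem' := by
    intro a b ha hb
    simp only [Set.mem_ofPred_eq, Subgroup.coe_mul, Units.val_mul, mul_inv_rev] at ha hb ⊢
    calc _ = ((a : (Cl p q)ˣ) : Cl p q) * (((b : (Cl p q)ˣ) : Cl p q) * f *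
          ((b : (Cl p q)ˣ)⁻¹ : (Cl p q)ˣ)) * ((a : (Cl p q)ˣ)⁻¹ : (Cl p q)ˣ) := by
            simp only [mul_assoc]
      _ = f := by rw [hb, ha]
  inv_mem' := by
    intro a ha
    simp only [Set.mem_ofPred_eq, Subgroup.coe_inv, inv_inv] at ha ⊢
    rw [Units.mul_inv_eq_iff_eq_mul] at ha
    rw [mul_assoc, Units.inv_mul_eq_iff_eq_mul, ha]

/-! ### Primitive idempotents -/

/-- The Radon–Hurwitz numbers: `r_0, …, r_7 = 0, 1, 2, 2, 3, 3, 3, 3` and `r_{i+8} = r_i + 4`. -/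
def radonHurwitz (i : ℤ) : ℤ :=
  4 * (i / 8) +
    (if i % 8 = 0 then 0 else if i % 8 = 1 then 1 else if i % 8 = 2 ∨ i % 8 = 3 then 2 else 3)

/-- The exponent `k = q - r_{q-p}`, which is never negative. -/
def spinorExponent (p q : ℕ) : ℕ := ((q : ℤ) - radonHurwitz ((q : ℤ) - p)).toNat

/-- The data of a primitive idempotent `½(1 ± e_{A_1}) ⋯ ½(1 ± e_{A_k})`: commuting basis monomials
`e_{A_1}, …, e_{A_k}` with square `1` which generate a group of order `2^k` that does not
contain `-1`, and a choice of signs. -/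
structure IdempotentData (p q : ℕ) where
  /-- The index sets `A_1, …, A_k`. -/
  index : Fin (spinorExponent p q) → Finset (Fin (p + q))
  /-- The signs. -/
  sign : Fin (spinorExponent p q) → ℤˣ
  commute : ∀ i j, Commute (monomial p q (index i)) (monomial p q (index j))
  square : ∀ i, monomial p q (index i) * monomial p q (index i) = 1
  card_group : Nat.card (Subgroup.closure (Set.range fun i => monomial p q (index i))) =
    2 ^ spinorExponent p q
  neg_one_notMem : -1 ∉ Subgroup.closure (Set.range fun i => monomial p q (index i))

namespace IdempotentData

variable {p q : ℕ} (D : IdempotentData p q)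

/-- The factor `½(1 ± e_{A_i})`. -/
def factor (i : Fin (spinorExponent p q)) : Cl p q :=
  (2⁻¹ : ℝ) • (1 + ((D.sign i : ℤ) : ℝ) • (monomial p q (D.index i) : Cl p q))

/-- The idempotent `f = ½(1 ± e_{A_1}) ⋯ ½(1 ± e_{A_k})`. -/
def idempotent : Cl p q := (List.ofFn D.factor).prod

theorem factor_mul_self (i : Fin (spinorExponent p q)) :
    IsIdempotentElem (D.factor i) := by
  have hs : (monomial p q (D.index i) : Cl p q) * (monomial p q (D.index i) : Cl p q) = 1 := by
    rw [← Units.val_mul, D.square, Units.val_one]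
  have h2 : ((D.sign i : ℤ) : ℝ) * ((D.sign i : ℤ) : ℝ) = 1 := by
    rcases Int.units_eq_one_or (D.sign i) with h | h <;> simp [h]
  unfold IsIdempotentElem factor
  rw [smul_mul_smul_comm, add_mul, one_mul, mul_add, mul_one, smul_mul_smul_comm, hs, h2]
  module

theorem factor_commute (i j : Fin (spinorExponent p q)) :
    Commute (D.factor i) (D.factor j) := by
  have h : Commute (monomial p q (D.index i) : Cl p q) (monomial p q (D.index j) : Cl p q) :=
    Commute.units_val (D.commute i j)
  unfold factor
  refine Commute.smul_left (Commute.smul_right ?_ _) _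
  exact (Commute.one_left _).add_left
    ((Commute.one_right _).add_right ((h.smul_left _).smul_right _))

theorem isIdempotentElem : IsIdempotentElem D.idempotent := by
  suffices H : ∀ l : List (Fin (spinorExponent p q)),
      IsIdempotentElem (l.map D.factor).prod by
    have := H (List.finRange _)
    rwa [← List.ofFn_eq_map] at this
  intro l
  induction l with
  | nil => exact IsIdempotentElem.one
  | cons a t ih =>
    rw [List.map_cons, List.prod_cons]
    refine IsIdempotentElem.mul_of_commute ?_ (D.factor_mul_self a) ih
    refine Commute.list_prod_right _ _ fun x hx => ?_
    obtain ⟨j, -, rfl⟩ := List.mem_map.1 hx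
    exact D.factor_commute a j

end IdempotentData

/-! ### The ring `K = f A f` and the spinor space `S = A f` -/

section Corner

variable {A : Type*} [Ring A] [Algebra ℝ A] {f : A} (hf : IsIdempotentElem f)

/-- `f A f` is a real algebra with unit `f`; scalars act as in `A`. -/
instance cornerModule : Module ℝ hf.Corner where
  smul c x := ⟨c • x.1, by
    obtain ⟨a, ha⟩ := x.2
    exact ⟨c • a, by simp [← ha]⟩⟩
  one_smul x := Subtype.ext (one_smul ℝ x.1)
  mul_smul c d x := Subtype.ext (mul_smul c d x.1)
  smul_zero c := Subtype.ext (smul_zero c)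
  smul_add c x y := Subtype.ext (smul_add c x.1 y.1)
  add_smul c d x := Subtype.ext (add_smul c d x.1)
  zero_smul x := Subtype.ext (zero_smul ℝ x.1)

instance cornerAlgebra : Algebra ℝ hf.Corner :=
  Algebra.ofModule (fun c x y => Subtype.ext (smul_mul_assoc c x.1 y.1))
    (fun c x y => Subtype.ext (mul_smul_comm c x.1 y.1))

/-- The spinor space `S = A f`, a left ideal of `A`. -/
abbrev SpinorSpace (_ : IsIdempotentElem f) : Type _ := Ideal.span {f}

/-- `S = A f` is a right module over `K = f A f`, by multiplication in `A`. -/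
instance spinorModule : Module hf.Cornerᵐᵒᵖ (SpinorSpace hf) where
  smul l x := ⟨x.1 * l.unop.1, by
    obtain ⟨a, ha⟩ := l.unop.2
    exact Ideal.mem_span_singleton'.2 ⟨x.1 * (f * a), by simp [← ha, mul_assoc]⟩⟩
  one_smul x := Subtype.ext <| by
    obtain ⟨a, ha⟩ := Ideal.mem_span_singleton'.1 x.2
    change x.1 * f = x.1
    rw [← ha, mul_assoc, hf.eq]
  mul_smul l m x := Subtype.ext (mul_assoc x.1 m.unop.1 l.unop.1).symm
  smul_zero l := Subtype.ext (zero_mul l.unop.1)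
  smul_add l x y := Subtype.ext (add_mul x.1 y.1 l.unop.1)
  add_smul l m x := Subtype.ext (mul_add x.1 l.unop.1 m.unop.1)
  zero_smul x := Subtype.ext (mul_zero x.1)

instance spinorSMulComm : SMulCommClass A hf.Cornerᵐᵒᵖ (SpinorSpace hf) where
  smul_comm a l x := Subtype.ext (mul_assoc a x.1 l.unop.1).symm

/-- The spinor representation `γ : A → End_K(S)`, `γ(u) ψ = u ψ`. -/
def spinorRep : A →+* Module.End hf.Cornerᵐᵒᵖ (SpinorSpace hf) :=
  Module.toModuleEnd hf.Cornerᵐᵒᵖ (SpinorSpace hf)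

/-- The matrix `[u]`, with entries in `K`, of `γ(u)` in a right `K`-basis `b` of `S`:
the `j`-th column consists of the coordinates of `u b_j`, so `u b_j = ∑ i, b_i [u]_{ij}`. -/
def spinorMatrix {ι : Type*} (b : Module.Basis ι hf.Cornerᵐᵒᵖ (SpinorSpace hf)) (u : A) :
    Matrix ι ι hf.Corner :=
  Matrix.of fun i j => (b.repr (spinorRep hf u (b j)) i).unop

end Corner

end CliffordSpinor

end

open CliffordSpinor

/-! Write G for `veeGroup`. It spans the algebra, its elements square to ±1 and commute up to sign,
and `transposition` acts on it as inversion; so everything reduces to the position of f relative to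
G.

An element g of G either commutes with every e_{A_i}, hence with f, or anticommutes with one of
them, and then e_{A_i} f = ±f forces f g f = 0. Therefore the conjugates m_i f m_i⁻¹ are orthogonal
idempotents. Their sum is proportional to the sum of all G-conjugates of f. Expand f: a nonempty
product of the e_{A_i} is an involution in G other than ±1. Since p - q is not 1 mod 4, it
anticommutes with some generator (`exists_anticommute`), so its conjugates cancel. Only the constant
term survives, and the sum of the m_i f m_i⁻¹ is the scalar 2⁻ᵏN. A nonzero idempotent scalar is 1.
This yields N = 2ᵏ and the basis at once (`card_eq_and_sum_conjugates`, `spinorBasis`).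

In this basis [u]_{ij} = f m_i⁻¹ u m_j f, so it remains to show that f T(a) f is the conjugate of f
a f (`map_toCorner_eq_star`). By linearity take a = g in G. If g does not commute with f, both sides
vanish. If g² = -1, then T(g) = -g and f g f is a square root of -1 in K, which conjugation negates.
If g² = 1, then T(g) = g, and g f = ±f is needed.

Let C be the `commutant` and D the `signCommutant`, where g f = ±f. Counting gives [C : D] ≤ 2ʳ with
r = p + q - 2k, which is 0, 1, 2 in the three cases; coset representatives of D in C span K. For r =
0, C = D. For r = 1, the central volume element, of square -1, represents the other coset. For r =
2, the signs of squares summed over C give the same total as over all of G, namely 2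
Re((1-i)(1+i)^p(1-i)^q) < 0. So fewer than half of C squares to 1, which forces all such elements
into D and makes the cosets 1, i, j, ij quaternionic. -/

namespace CliffordSpinor

/-! ### Independence of commuting involutions. -/

section Independence

/-- The homomorphism from the group of signs determined by an involution `h`. -/
def involutionHom {M : Type*} [Monoid M] (h : M) (hh : h * h = 1) : ℤˣ →* M where
  toFun e := if e = 1 then 1 else h
  map_one' := if_pos rfl
  map_mul' a b := by
    have hne : (-1 : ℤˣ) ≠ 1 := by decide
    rcases Int.units_eq_one_or a with rfl | rfl <;> rcases Int.units_eq_one_or b with rfl | rfl <;>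
      simp [hh, hne]

theorem involutionHom_neg_one {M : Type*} [Monoid M] (h : M) (hh : h * h = 1) :
    involutionHom h hh (-1) = h := by
  simp [involutionHom, show ¬ (-1 : ℤˣ) = 1 by decide]

/-- If `k` commuting involutions generate a group of order `2 ^ k`, then they are independent. -/
theorem list_prod_ne_one_of_card_closure {M : Type*} [Group M] {k : ℕ} (h : Fin k → M)
    (hcomm : ∀ i j, Commute (h i) (h j)) (hsq : ∀ i, h i * h i = 1)
    (hcard : Nat.card (Subgroup.closure (Set.range h)) = 2 ^ k)
    {s : List (Fin k)} (hs : s.Nodup) (hne : s ≠ []) : (s.map h).prod ≠ 1 := by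
  let φ : ∀ i, ℤˣ →* M := fun i => involutionHom (h i) (hsq i)
  have hφ : Pairwise fun i j => ∀ x y, Commute (φ i x) (φ j y) := by
    intro i j _ x y
    simp only [φ, involutionHom, MonoidHom.coe_mk, OneHom.coe_mk]
    split_ifs <;> simp [hcomm i j]
  let Φ := MonoidHom.noncommPiCoprod φ hφ
  have hΦ : ∀ i, Φ (Pi.mulSingle i (-1)) = h i := fun i => by
    simp only [Φ]
    rw [MonoidHom.noncommPiCoprod_mulSingle]
    exact involutionHom_neg_one _ _
  have hle : Subgroup.closure (Set.range h) ≤ Φ.range := by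
    rw [Subgroup.closure_le]
    rintro _ ⟨i, rfl⟩
    exact ⟨_, hΦ i⟩
  -- The range contains the closure, of order 2 ^ k, while the domain has exactly 2 ^ k elements.
  have hinj : Function.Injective Φ := by
    have hc : Nat.card (Fin k → ℤˣ) = 2 ^ k := by
      rw [Nat.card_eq_fintype_card, Fintype.card_fun, Fintype.card_units_int, Fintype.card_fin]
    have hfin : Finite Φ.range := Finite.of_surjective _ Φ.rangeRestrict_surjective
    have h1 : Nat.card Φ.range = Nat.card (Fin k → ℤˣ) := by
      refine le_antisymm ?_ ?_
      · exact Nat.card_le_card_of_surjective Φ.rangeRestrict Φ.rangeRestrict_surjective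
      · rw [hc, ← hcard]
        exact Nat.card_le_card_of_injective _ (Subgroup.inclusion_injective hle)
    have h2 : Function.Bijective Φ.rangeRestrict :=
      (Nat.bijective_iff_surjective_and_card _).2 ⟨Φ.rangeRestrict_surjective, h1.symm⟩
    exact fun a b hab => h2.1 (Subtype.ext hab)
  intro hprod
  have h1 : Φ (s.map fun i => (Pi.mulSingle i (-1) : Fin k → ℤˣ)).prod = 1 := by
    rw [map_list_prod, List.map_map, ← hprod]
    exact congrArg List.prod (List.map_congr_left fun i _ => hΦ i)
  have h2 := hinj (h1.trans (map_one Φ).symm)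
  cases s with
  | nil => exact hne rfl
  | cons a t =>
    -- The coordinate at the head `a` is -1, because `a` does not recur in the tail.
    have h3 := congrFun h2 a
    rw [List.map_cons, List.prod_cons, Pi.mul_apply, Pi.mulSingle_eq_same] at h3
    have h4 : (t.map fun i => (Pi.mulSingle i (-1) : Fin k → ℤˣ)).prod a = 1 := by
      have h5 : a ∉ t := (List.nodup_cons.1 hs).1
      clear h2 h3 h1 hprod hs hne
      induction t with
      | nil => rfl
      | cons b t ih =>
        rw [List.mem_cons, not_or] at h5
        rw [List.map_cons, List.prod_cons, Pi.mul_apply, Pi.mulSingle_eq_of_ne h5.1, one_mul,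
          ih h5.2]
    rw [h4] at h3
    exact absurd (show (-1 : ℤˣ) * 1 = 1 from h3) (by decide)

end Independence

theorem eq_zero_of_eq_neg {B : Type*} [AddCommGroup B] [Module ℝ B] {x : B} (h : x = -x) :
    x = 0 := by
  have h2 : (2 : ℝ) • x = 0 := by
    rw [two_smul]; nth_rewrite 1 [h]; simp
  exact (smul_eq_zero.1 h2).resolve_left two_ne_zero

/-! ### Sums of conjugates. -/

section Average

variable {A B : Type*} [Ring A] [Algebra ℝ A]

/-- Expanding the product gives one term per sublist, and only the empty one survives `Φ`. The left
factor `y` is carried along so that the induction can absorb the head. -/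
theorem map_mul_list_prod_one_add [AddCommGroup B] [Module ℝ B] {ι : Type*} (Φ : A →ₗ[ℝ] B)
    (x : ι → A) (l : List ι) (y : A)
    (h : ∀ s : List ι, s.Sublist l → s ≠ [] → Φ (y * (s.map x).prod) = 0) :
    Φ (y * (l.map fun i => 1 + x i).prod) = Φ y := by
  induction l generalizing y with
  | nil => simp
  | cons a t ih =>
    rw [List.map_cons, List.prod_cons, add_mul, one_mul, mul_add, map_add,
      ih y fun s hs => h s (hs.cons a), ← mul_assoc, ih (y * x a), add_eq_left]
    · simpa using h [a] (by simp) (by simp)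
    · intro s hs _
      simpa [mul_assoc] using h (a :: s) (hs.cons_cons a) (by simp)

variable (G : Subgroup Aˣ) [Fintype G]

/-- The sum of the conjugates of `a` under the finite group `G`. -/
def conjSum : A →ₗ[ℝ] A where
  toFun a := ∑ g : G, (g : Aˣ).1 * a * ((g : Aˣ)⁻¹).1
  map_add' a b := by simp only [mul_add, add_mul, Finset.sum_add_distrib]
  map_smul' c a := by
    simp only [mul_smul_comm, smul_mul_assoc, Finset.smul_sum, RingHom.id_apply]

theorem conjSum_apply (a : A) :
    conjSum G a = ∑ g : G, (g : Aˣ).1 * a * ((g : Aˣ)⁻¹).1 := rfl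

theorem conjSum_one : conjSum G (1 : A) = algebraMap ℝ A (Nat.card G) := by
  simp [conjSum_apply, Nat.card_eq_fintype_card]

/-- Conjugating `a` by `g` only reindexes the sum, yet it also changes the sign of `a`. -/
theorem conjSum_eq_zero {g : Aˣ} (hg : g ∈ G) {a : A} (h : g * a = -(a * g)) :
    conjSum G a = 0 := by
  have h1 : conjSum G (g * a * (g⁻¹).1) = conjSum G a := by
    rw [conjSum_apply, conjSum_apply]
    refine Fintype.sum_equiv (Equiv.mulRight ⟨g, hg⟩) _ _ fun x => ?_
    simp [mul_assoc]
  rw [h, neg_mul, mul_assoc, Units.mul_inv, mul_one, map_neg] at h1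
  exact eq_zero_of_eq_neg h1.symm

end Average

/-! ### Transversals and the spinor basis. -/

section Transversal

variable {G : Type*} [Group G] (C : Subgroup G) {N : ℕ} (m : Fin N → G)

theorem transversal_bijective
    (hm : Function.Bijective fun i => (QuotientGroup.mk (m i) : G ⧸ C)) :
    Function.Bijective fun x : Fin N × C => m x.1 * x.2 := by
  constructor
  · rintro ⟨i, c⟩ ⟨j, d⟩ h
    have h' : m i * c = m j * d := h
    have hij : i = j := by
      apply hm.1
      change (QuotientGroup.mk (m i) : G ⧸ C) = QuotientGroup.mk (m j)
      rw [← QuotientGroup.mk_mul_of_mem (m i) c.2, h', QuotientGroup.mk_mul_of_mem _ d.2]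
    subst hij
    exact Prod.ext rfl (Subtype.ext (mul_left_cancel h'))
  · intro g
    obtain ⟨i, hi⟩ := hm.2 (QuotientGroup.mk g)
    exact ⟨(i, ⟨(m i)⁻¹ * g, QuotientGroup.eq.1 hi⟩), by simp⟩

end Transversal

section Basis

variable {A : Type*} [Ring A] [Algebra ℝ A] {f : A} (hf : IsIdempotentElem f) {ι : Type*}
  [Fintype ι] (m : ι → Aˣ)

theorem mem_spinorSpace {A : Type*} [Ring A] {f : A} (hf : IsIdempotentElem f) {x : A} : x ∈ Ideal.span {f} ↔ x * f = x := by
  rw [Ideal.mem_span_singleton']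
  exact ⟨fun ⟨a, ha⟩ => by rw [← ha, mul_assoc, hf.eq], fun h => ⟨x, h⟩⟩

theorem corner_mul_right {A : Type*} [Ring A] {f : A} (hf : IsIdempotentElem f) (c : hf.Corner) : c.1 * f = c.1 := by
  obtain ⟨a, ha⟩ := c.2
  rw [← ha, mul_assoc, hf.eq]

theorem corner_mul_left {A : Type*} [Ring A] {f : A} (hf : IsIdempotentElem f) (c : hf.Corner) : f * c.1 = c.1 := by
  obtain ⟨a, ha⟩ := c.2
  rw [← ha, ← mul_assoc, ← mul_assoc, hf.eq]

/-- The element `f a f` of the corner ring. -/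
def toCorner : A →ₗ[ℝ] hf.Corner where
  toFun a := ⟨f * a * f, a, rfl⟩
  map_add' a b := Subtype.ext (show f * (a + b) * f = f * a * f + f * b * f by
    rw [mul_add, add_mul])
  map_smul' c a := Subtype.ext (show f * (c • a) * f = c • (f * a * f) by simp)

@[simp] theorem toCorner_val (a : A) : (toCorner hf a).1 = f * a * f := rfl

theorem toCorner_surjective : Function.Surjective (toCorner hf) := by
  rintro ⟨_, a, rfl⟩
  exact ⟨a, rfl⟩

/-- The basis `m_i f` of the spinor space, if the idempotents `m_i f m_i⁻¹` are orthogonal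
with sum `1`. -/
noncomputable def spinorBasis [DecidableEq ι]
    (horth : ∀ i j, i ≠ j → f * ((m i)⁻¹).1 * (m j).1 * f = 0)
    (hsum : ∑ i, (m i).1 * f * ((m i)⁻¹).1 = 1) :
    Module.Basis ι hf.Cornerᵐᵒᵖ (SpinorSpace hf) :=
  Module.Basis.ofEquivFun
    { toFun := fun x i => MulOpposite.op (toCorner hf (((m i)⁻¹).1 * x.1))
      map_add' := fun x y => by
        funext i
        exact congrArg MulOpposite.op (by simp [mul_add])
      map_smul' := fun c x => by
        funext i
        refine congrArg MulOpposite.op (Subtype.ext ?_)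
        change f * (((m i)⁻¹).1 * (x.1 * c.unop.1)) * f = f * (((m i)⁻¹).1 * x.1) * f * c.unop.1
        rw [mul_assoc _ _ c.unop.1, corner_mul_left]
        simp only [mul_assoc, corner_mul_right]
      invFun := fun c => ⟨∑ i, (m i).1 * (c i).unop.1,
        (mem_spinorSpace hf).2 (by simp [Finset.sum_mul, mul_assoc, corner_mul_right])⟩
      left_inv := fun x => by
        have hx := (mem_spinorSpace hf).1 x.2
        refine Subtype.ext ?_
        change ∑ i, (m i).1 * (f * (((m i)⁻¹).1 * x.1) * f) = x.1
        calc _ = ∑ i, (m i).1 * f * ((m i)⁻¹).1 * x.1 :=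
              Finset.sum_congr rfl fun i _ => by simp only [mul_assoc, hx]
          _ = x.1 := by rw [← Finset.sum_mul, hsum, one_mul]
      right_inv := fun c => by
        funext i
        refine MulOpposite.unop_injective (Subtype.ext ?_)
        change f * (((m i)⁻¹).1 * ∑ j, (m j).1 * (c j).unop.1) * f = (c i).unop.1
        rw [Finset.mul_sum, Finset.mul_sum, Finset.sum_mul, Finset.sum_eq_single i]
        · simp [corner_mul_left, corner_mul_right]
        · intro j _ hj
          rw [← corner_mul_left hf (c j).unop]
          have := horth i j hj.symm
          simp only [← mul_assoc] at this ⊢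
          rw [this, zero_mul, zero_mul]
        · simp }

variable [DecidableEq ι]
    (horth : ∀ i j, i ≠ j → f * ((m i)⁻¹).1 * (m j).1 * f = 0)
    (hsum : ∑ i, (m i).1 * f * ((m i)⁻¹).1 = 1)

theorem spinorBasis_apply (i : ι) :
    (spinorBasis hf m horth hsum i : A) = (m i).1 * f := by
  rw [spinorBasis, Module.Basis.coe_ofEquivFun]
  change ∑ j, (m j).1 * ((Pi.single i (1 : hf.Cornerᵐᵒᵖ) : ι → _) j).unop.1 = _
  rw [Finset.sum_eq_single i]
  · rw [Pi.single_eq_same]; rfl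
  · intro j _ hj
    rw [Pi.single_eq_of_ne hj]
    exact mul_zero _
  · simp

/-- This formula turns transposing the matrix into a statement about single elements of the corner
ring. -/
theorem spinorMatrix_spinorBasis (u : A) (i j : ι) :
    spinorMatrix hf (spinorBasis hf m horth hsum) u i j =
      toCorner hf (((m i)⁻¹).1 * u * (m j).1) := by
  refine Subtype.ext ?_
  change f * (((m i)⁻¹).1 * (u * (spinorBasis hf m horth hsum j : A))) * f = _
  rw [spinorBasis_apply]
  simp [mul_assoc, hf.eq]

end Basis

end CliffordSpinor

namespace CliffordSpinor

/-! ### Counting cosets. -/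

section Cosets

variable {Γ : Type*} [Group Γ] {C D : Subgroup Γ}

/-- The cosets t_i D are disjoint and lie in `C`, so by cardinality they already fill it. -/
theorem exists_mem_coset_of_card_le [Finite C] (hDC : D ≤ C) {r : ℕ} (t : Fin r → Γ)
    (ht : ∀ i, t i ∈ C) (hinj : ∀ i j, (t i)⁻¹ * t j ∈ D → i = j)
    (hcard : Nat.card C ≤ r * Nat.card D) {c : Γ} (hc : c ∈ C) : ∃ i, (t i)⁻¹ * c ∈ D := by
  let F : Fin r × D → C := fun x => ⟨t x.1 * x.2, C.mul_mem (ht _) (hDC x.2.2)⟩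
  have hF : Function.Injective F := by
    rintro ⟨i, d⟩ ⟨j, e⟩ h
    have h' : t i * d = t j * e := congrArg Subtype.val h
    have hij : i = j := by
      apply hinj
      have : (t i)⁻¹ * t j = d * (e : Γ)⁻¹ := by
        rw [eq_mul_inv_iff_mul_eq, mul_assoc, ← h', inv_mul_cancel_left]
      rw [this]
      exact D.mul_mem d.2 (D.inv_mem e.2)
    subst hij
    exact Prod.ext rfl (Subtype.ext (mul_left_cancel h'))
  have hb : Function.Bijective F := by
    refine (Nat.bijective_iff_injective_and_card F).2 ⟨hF, le_antisymm ?_ ?_⟩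
    · exact Nat.card_le_card_of_injective F hF
    · simpa using hcard
  obtain ⟨⟨i, d⟩, h⟩ := hb.2 ⟨c, hc⟩
  have h' : t i * d = c := congrArg Subtype.val h
  exact ⟨i, by rw [← h', inv_mul_cancel_left]; exact d.2⟩

end Cosets

/-! ### The corner ring: conjugation and the three division algebras. -/

section Corner

variable {A : Type*} [Ring A]

/-- The elements of `G` commuting with `f`. -/
def commutant (G : Subgroup Aˣ) (f : A) : Subgroup Aˣ where
  carrier := {g | g ∈ G ∧ g * f = f * g}
  one_mem' := ⟨G.one_mem, by simp⟩
  mul_mem' {a b} ha hb := ⟨G.mul_mem ha.1 hb.1, by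
    rw [Units.val_mul, mul_assoc, hb.2, ← mul_assoc, ha.2, mul_assoc]⟩
  inv_mem' {a} ha := ⟨G.inv_mem ha.1, by
    rw [Units.inv_mul_eq_iff_eq_mul, ← mul_assoc, ha.2, mul_assoc, Units.mul_inv, mul_one]⟩

/-- The elements of `G` commuting with `f` and acting on `f` by a sign. -/
def signCommutant (G : Subgroup Aˣ) (f : A) : Subgroup Aˣ where
  carrier := {g | g ∈ commutant G f ∧ (g * f = f ∨ g * f = -f)}
  one_mem' := ⟨Subgroup.one_mem _, by simp⟩
  mul_mem' {a b} ha hb := ⟨Subgroup.mul_mem _ ha.1 hb.1, by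
    rw [Units.val_mul, mul_assoc]
    rcases ha.2 with h | h <;> rcases hb.2 with h' | h' <;> simp [h, h']⟩
  inv_mem' {a} ha := ⟨Subgroup.inv_mem _ ha.1, by
    rw [Units.inv_mul_eq_iff_eq_mul, Units.inv_mul_eq_iff_eq_mul]
    rcases ha.2 with h | h <;> simp [h]⟩

theorem signCommutant_le (G : Subgroup Aˣ) (f : A) : signCommutant G f ≤ commutant G f :=
  fun _ h => h.1

variable [Algebra ℝ A] {f : A} (hf : IsIdempotentElem f)

theorem toCorner_one : toCorner hf 1 = 1 := Subtype.ext (by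
  change f * 1 * f = f
  rw [mul_one, hf.eq])

theorem toCorner_mul {a : A} (ha : a * f = f * a) (b : A) :
    toCorner hf (a * b) = toCorner hf a * toCorner hf b := Subtype.ext (by
  change f * (a * b) * f = f * a * f * (f * b * f)
  have h : f * a * f = f * a := by rw [mul_assoc, ha, ← mul_assoc, hf.eq]
  rw [h, ← mul_assoc (f * a), ← mul_assoc (f * a), h, mul_assoc f a b])

variable {G : Subgroup Aˣ}

theorem toCorner_of_mem_signCommutant {g : Aˣ} (hg : g ∈ signCommutant G f) :
    toCorner hf g = 1 ∨ toCorner hf g = -1 := by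
  rcases hg.2 with h | h
  · refine Or.inl (Subtype.ext ?_)
    change f * g * f = f
    rw [mul_assoc, h, hf.eq]
  · refine Or.inr (Subtype.ext ?_)
    change f * g * f = -f
    rw [mul_assoc, h, mul_neg, hf.eq]

/-- The compressions of `G` span the corner, and those from outside the commutant vanish. -/
theorem corner_induction (hspan : Submodule.span ℝ (Units.val '' (G : Set Aˣ)) = ⊤)
    (hdich : ∀ g ∈ G, g ∉ commutant G f → f * g * f = 0) (V : Submodule ℝ hf.Corner)
    (h : ∀ g ∈ commutant G f, toCorner hf g ∈ V) : V = ⊤ := by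
  have h1 : Submodule.span ℝ (Units.val '' (G : Set Aˣ)) ≤ V.comap (toCorner hf) := by
    rw [Submodule.span_le]
    rintro _ ⟨g, hg, rfl⟩
    by_cases hgC : g ∈ commutant G f
    · exact h g hgC
    · have : toCorner hf (g : A) = 0 := Subtype.ext (hdich g hg hgC)
      change toCorner hf (g : A) ∈ V
      rw [this]
      exact V.zero_mem
  rw [hspan] at h1
  refine eq_top_iff.2 fun x _ => ?_
  obtain ⟨a, rfl⟩ := toCorner_surjective hf x
  exact h1 (Submodule.mem_top (x := a))

/-- The common core of the three cases. On `G` inversion is multiplication by ±1 according to the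
square: square 1 gives the self-conjugate values ±1 or 0, and square -1 gives 0 or a root of -1,
which `star` negates. -/
theorem map_toCorner_eq_star {B : Type*} [Ring B] [Algebra ℝ B] [StarRing B]
    (hsmul : ∀ (r : ℝ) (x : B), star (r • x) = r • star x)
    (hB : ∀ x : B, x * x = -1 → star x = -x)
    (hspan : Submodule.span ℝ (Units.val '' (G : Set Aˣ)) = ⊤)
    (hdich : ∀ g ∈ G, g ∉ commutant G f → f * g * f = 0)
    (hsq : ∀ g ∈ G, g * g = 1 ∨ g * g = -1)
    (hsign : ∀ g ∈ commutant G f, g * g = 1 → g ∈ signCommutant G f)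
    (T : A →ₗ[ℝ] A) (hT : ∀ g ∈ G, T g = (g⁻¹).1) (φ : hf.Corner →ₐ[ℝ] B) (a : A) :
    φ (toCorner hf (T a)) = star (φ (toCorner hf a)) := by
  have ha : a ∈ Submodule.span ℝ (Units.val '' (G : Set Aˣ)) := hspan ▸ Submodule.mem_top
  induction ha using Submodule.span_induction with
  | zero => simp
  | add x y _ _ hx hy => simp only [map_add, hx, hy, star_add]
  | smul c x _ hx => simp only [map_smul, hx, hsmul]
  | mem x hx =>
    obtain ⟨g, hg, rfl⟩ := hx
    rw [hT g hg]
    rcases hsq g hg with h | h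
    · rw [inv_eq_of_mul_eq_one_right h]
      by_cases hgC : g ∈ commutant G f
      · rcases toCorner_of_mem_signCommutant hf (hsign g hgC h) with h | h <;> simp [h]
      · have : toCorner hf (g : A) = 0 := Subtype.ext (hdich g hg hgC)
        simp [this]
    · rw [inv_eq_of_mul_eq_one_right (show g * -g = 1 by rw [mul_neg, h, neg_neg]),
        Units.val_neg, map_neg, map_neg]
      by_cases hgC : g ∈ commutant G f
      · refine (hB _ ?_).symm
        rw [← map_mul, ← toCorner_mul hf hgC.2, ← Units.val_mul, h, Units.val_neg, map_neg,
          Units.val_one, toCorner_one, map_neg, map_one]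
      · have : toCorner hf (g : A) = 0 := Subtype.ext (hdich g hg hgC)
        simp [this]

theorem nontrivial_corner {A : Type*} [Ring A] {f : A} (hf : IsIdempotentElem f) (h0 : f ≠ 0) : Nontrivial hf.Corner :=
  ⟨1, 0, fun h => h0 (congrArg Subtype.val h)⟩

theorem nonempty_corner_algEquiv_real (h0 : f ≠ 0)
    (hspan : Submodule.span ℝ (Units.val '' (G : Set Aˣ)) = ⊤)
    (hdich : ∀ g ∈ G, g ∉ commutant G f → f * g * f = 0)
    (hC : commutant G f ≤ signCommutant G f) : Nonempty (hf.Corner ≃ₐ[ℝ] ℝ) := by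
  have := nontrivial_corner hf h0
  refine ⟨(AlgEquiv.ofBijective (Algebra.ofId ℝ hf.Corner)
    ⟨(Algebra.ofId ℝ hf.Corner).toRingHom.injective, ?_⟩).symm⟩
  have := corner_induction hf hspan hdich (LinearMap.range (Algebra.ofId ℝ hf.Corner).toLinearMap)
    fun g hg => by
      rcases toCorner_of_mem_signCommutant hf (hC hg) with h | h
      · exact ⟨1, by simp [h]⟩
      · exact ⟨-1, by simp [h]⟩
  exact LinearMap.range_eq_top.1 this

theorem mem_range_of_coset {B : Type*} [Ring B] [Algebra ℝ B] (φ : B →ₐ[ℝ] hf.Corner)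
    {t c : Aˣ} (ht : t ∈ commutant G f) (hφ : toCorner hf t ∈ LinearMap.range φ.toLinearMap)
    (hc : t⁻¹ * c ∈ signCommutant G f) : toCorner hf c ∈ LinearMap.range φ.toLinearMap := by
  have h1 : toCorner hf c = toCorner hf t * toCorner hf (t⁻¹ * c).1 := by
    rw [← toCorner_mul hf ht.2, ← Units.val_mul, mul_inv_cancel_left]
  rw [h1]
  rcases toCorner_of_mem_signCommutant hf hc with h | h
  · rwa [h, mul_one]
  · rw [h, mul_neg_one (toCorner hf (t : A))]
    exact Submodule.neg_mem _ hφ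

/-- Applying `g` twice to `f` squares a sign, so it fixes `f`; this excludes square -1. -/
theorem sq_eq_one_of_mem_signCommutant (h0 : f ≠ 0) (hsq : ∀ g ∈ G, g * g = 1 ∨ g * g = -1)
    {g : Aˣ} (hg : g ∈ signCommutant G f) : g * g = 1 := by
  refine (hsq g hg.1.1).resolve_right fun h => h0 ?_
  have h1 : (g : A) * (g * f) = -f := by
    rw [← mul_assoc, ← Units.val_mul, h, Units.val_neg, Units.val_one, neg_one_mul]
  have h2 : (g : A) * (g * f) = f := by
    rcases hg.2 with h | h <;> simp [h]
  exact eq_zero_of_eq_neg (h2.symm.trans h1)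

/-! ### The complex case. -/

section Complex

variable [Finite G] (h0 : f ≠ 0) (hsq : ∀ g ∈ G, g * g = 1 ∨ g * g = -1)
  {ω : Aˣ} (hω : ω ∈ G) (hω2 : ω * ω = -1) (hcen : ∀ a : A, ω * a = a * ω)
  (hcard : Nat.card (commutant G f) ≤ 2 * Nat.card (signCommutant G f))

instance finite_commutant : Finite (commutant G f) :=
  Finite.of_injective _ (Subgroup.inclusion_injective (fun _ h => h.1 : commutant G f ≤ G))

include h0 hsq hω hω2 hcen hcard

theorem coset_central {g : Aˣ} (hg : g ∈ commutant G f) :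
    g ∈ signCommutant G f ∨ ω⁻¹ * g ∈ signCommutant G f := by
  have hωD : ω ∉ signCommutant G f := fun h => by
    have h1 := sq_eq_one_of_mem_signCommutant h0 hsq h
    rw [hω2] at h1
    refine h0 (eq_zero_of_eq_neg ?_)
    have h2 := congrArg (fun u : Aˣ => (u : A) * f) h1
    simpa using h2.symm
  obtain ⟨i, hi⟩ := exists_mem_coset_of_card_le (signCommutant_le G f) ![1, ω]
    (fun i => by fin_cases i; exacts [Subgroup.one_mem _, ⟨hω, hcen f⟩])
    (fun i j h => by
      fin_cases i <;> fin_cases j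
      · rfl
      · exact absurd (by simpa using h) hωD
      · exact absurd (by simpa using h) hωD
      · rfl) hcard hg
  fin_cases i
  · exact Or.inl (by simpa using hi)
  · exact Or.inr (by simpa using hi)

/-- In the other coset ω⁻¹g would have square 1, but centrality of ω makes that square -1. -/
theorem mem_signCommutant_of_central {g : Aˣ} (hg : g ∈ commutant G f) (h : g * g = 1) :
    g ∈ signCommutant G f := by
  refine (coset_central h0 hsq hω hω2 hcen hcard hg).resolve_right fun hD => h0 ?_
  have h1 := sq_eq_one_of_mem_signCommutant h0 hsq hD
  have h2 : Commute ω g := Units.ext (hcen g)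
  have h3 : ω⁻¹ * g * (ω⁻¹ * g) = (ω * ω)⁻¹ * (g * g) := by
    rw [mul_inv_rev, (h2.inv_left.symm).mul_mul_mul_comm]
  rw [h3, h, hω2, mul_one, inv_neg, inv_one] at h1
  refine eq_zero_of_eq_neg ?_
  have h2 := congrArg (fun u : Aˣ => (u : A) * f) h1
  simpa using h2.symm

theorem nonempty_corner_algEquiv_complex
    (hspan : Submodule.span ℝ (Units.val '' (G : Set Aˣ)) = ⊤)
    (hdich : ∀ g ∈ G, g ∉ commutant G f → f * g * f = 0) : Nonempty (hf.Corner ≃ₐ[ℝ] ℂ) := by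
  have := nontrivial_corner hf h0
  have hωC : ω ∈ commutant G f := ⟨hω, hcen f⟩
  have hI : toCorner hf ω * toCorner hf ω = -1 := by
    rw [← toCorner_mul hf (hcen f), ← Units.val_mul, hω2, Units.val_neg, map_neg, Units.val_one,
      toCorner_one]
  let φ : ℂ →ₐ[ℝ] hf.Corner := Complex.lift ⟨toCorner hf ω, hI⟩
  -- A field maps injectively into a nontrivial ring, so only surjectivity is left.
  refine ⟨(AlgEquiv.ofBijective φ ⟨φ.toRingHom.injective, ?_⟩).symm⟩
  have := corner_induction hf hspan hdich (LinearMap.range φ.toLinearMap) fun g hg => by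
    rcases coset_central h0 hsq hω hω2 hcen hcard hg with h | h
    · refine mem_range_of_coset hf φ (t := 1) (Subgroup.one_mem _) ⟨1, ?_⟩ (by simpa using h)
      simp [toCorner_one]
    · exact mem_range_of_coset hf φ hωC ⟨Complex.I, by simp [φ]⟩ h
  exact LinearMap.range_eq_top.1 this

end Complex

/-! ### The quaternionic case. -/

section Quaternion

variable (h0 : f ≠ 0) (hsq : ∀ g ∈ G, g * g = 1 ∨ g * g = -1)
  (hcard : Nat.card (commutant G f) ≤ 4 * Nat.card (signCommutant G f))
  (hlt : 2 * Nat.card {g // g ∈ commutant G f ∧ g * g = 1} < Nat.card (commutant G f))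
  (hcomm : ∀ g ∈ G, ∀ h ∈ G, g * h = h * g ∨ g * h = -(h * g))

-- If c and d anticommuted, evaluating both products on `f`, where d acts by a sign, would give c f
-- = -c f and hence f = 0.
include h0 hcomm in
theorem commute_of_mem_signCommutant {c d : Aˣ} (hc : c ∈ commutant G f)
    (hd : d ∈ signCommutant G f) : c * d = d * c := by
  refine (hcomm c hc.1 d hd.1.1).resolve_right fun h => h0 ?_
  have h1 : (c : A) * (d * f) = -(d * (f * c)) := by
    rw [← hc.2, ← mul_assoc, ← mul_assoc, ← Units.val_mul, h, Units.val_neg, Units.val_mul, neg_mul]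
  rw [← mul_assoc (d : A) f] at h1
  have h2 : (c : A) * f = 0 := by
    refine eq_zero_of_eq_neg ?_
    rcases hd.2 with h | h
    · rw [h, ← hc.2] at h1
      exact h1
    · rw [h, neg_mul, neg_neg, ← hc.2, mul_neg] at h1
      exact h1.symm
  simpa using congrArg (fun x => (c⁻¹).1 * x) h2

variable [Finite G]

instance finite_sq : Finite {g // g ∈ commutant G f ∧ g * g = 1} :=
  Finite.of_injective (fun x => (⟨x.1, x.2.1⟩ : commutant G f))
    fun _ _ h => Subtype.ext (congrArg (fun z : commutant G f => z.1) h)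

-- For an involution g of C outside D, both D and gD would consist of elements of square 1. Those
-- 2|D| elements are at least half of C, contrary to `hlt`.
include h0 hcomm hsq hcard hlt in
theorem mem_signCommutant_of_card_lt {g : Aˣ} (hg : g ∈ commutant G f) (h : g * g = 1) :
    g ∈ signCommutant G f := by
  by_contra hgD
  let F : signCommutant G f ⊕ signCommutant G f → {g // g ∈ commutant G f ∧ g * g = 1} :=
    Sum.elim (fun d => ⟨d, d.2.1, sq_eq_one_of_mem_signCommutant h0 hsq d.2⟩)
      fun d => ⟨g * d, Subgroup.mul_mem _ hg d.2.1, by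
        have h1 : Commute g d := commute_of_mem_signCommutant h0 hcomm hg d.2
        rw [h1.symm.mul_mul_mul_comm, h, sq_eq_one_of_mem_signCommutant h0 hsq d.2, one_mul]⟩
  have hF : Function.Injective F := by
    have key : ∀ d e : signCommutant G f, (d : Aˣ) ≠ g * e := fun d e h => hgD <| by
      rw [← mul_inv_eq_iff_eq_mul.2 h]
      exact Subgroup.mul_mem _ d.2 (Subgroup.inv_mem _ e.2)
    rintro (d | d) (e | e) h <;> have h' := congrArg (fun x => x.1) h
    · exact congrArg Sum.inl (Subtype.ext h')
    · exact absurd h' (key d e)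
    · exact absurd h'.symm (key e d)
    · exact congrArg Sum.inr (Subtype.ext (mul_left_cancel h'))
  have hfin : Finite (signCommutant G f) :=
    Finite.of_injective _ (Subgroup.inclusion_injective (signCommutant_le G f))
  have := Nat.card_le_card_of_injective F hF
  rw [Nat.card_sum] at this
  omega

include h0 hcomm hsq hcard hlt in
theorem nonempty_corner_algEquiv_quaternion (hneg : -1 ∈ G)
    (hspan : Submodule.span ℝ (Units.val '' (G : Set Aˣ)) = ⊤)
    (hdich : ∀ g ∈ G, g ∉ commutant G f → f * g * f = 0) :
    Nonempty (hf.Corner ≃ₐ[ℝ] Quaternion ℝ) := by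
  have := nontrivial_corner hf h0
  set D := signCommutant G f with hD
  have hfin : Finite D :=
    Finite.of_injective _ (Subgroup.inclusion_injective (signCommutant_le G f))
  have hmem : ∀ {g : Aˣ}, g ∈ commutant G f → g * g = 1 → g ∈ D :=
    mem_signCommutant_of_card_lt h0 hsq hcard hlt hcomm
  have hDle : Nat.card D ≤ Nat.card {g // g ∈ commutant G f ∧ g * g = 1} :=
    Nat.card_le_card_of_injective
      (fun d => ⟨d.1, d.2.1, sq_eq_one_of_mem_signCommutant h0 hsq d.2⟩)
      fun x y h => Subtype.ext (congrArg (fun x => x.1) h)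
  have hnegD : (-1 : Aˣ) ∈ D := hmem ⟨hneg, by simp⟩ (by simp)
  have hmneg : ∀ {g : Aˣ}, -g ∈ D → g ∈ D := fun {g} h => by
    simpa using D.mul_mem hnegD h
  obtain ⟨i, hi, hiD⟩ : ∃ i ∈ commutant G f, i ∉ D := by
    by_contra! h
    have : Nat.card (commutant G f) ≤ Nat.card D :=
      Nat.card_le_card_of_injective _ (Subgroup.inclusion_injective h)
    omega
  -- If D and iD covered C, then |C| ≤ 2|D|; but D consists of elements of square 1, which make up
  -- less than half of C.
  obtain ⟨j, hj, hjD, hijD⟩ : ∃ j ∈ commutant G f, j ∉ D ∧ i⁻¹ * j ∉ D := by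
    by_contra! h
    let F : D ⊕ D → commutant G f :=
      Sum.elim (fun d => ⟨d, d.2.1⟩) fun d => ⟨i * d, Subgroup.mul_mem _ hi d.2.1⟩
    have hF : Function.Surjective F := fun c => by
      by_cases hc : c.1 ∈ D
      · exact ⟨Sum.inl ⟨c, hc⟩, rfl⟩
      · exact ⟨Sum.inr ⟨i⁻¹ * c, h c c.2 hc⟩, Subtype.ext (mul_inv_cancel_left i c.1)⟩
    have := Nat.card_le_card_of_surjective F hF
    rw [Nat.card_sum] at this
    omega
  have hii : i * i = -1 := (hsq i hi.1).resolve_left fun h => hiD (hmem hi h)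
  have hjj : j * j = -1 := (hsq j hj.1).resolve_left fun h => hjD (hmem hj h)
  have hinv : i⁻¹ = -i := inv_eq_of_mul_eq_one_right (by rw [mul_neg, hii, neg_neg])
  have hjinv : j⁻¹ = -j := inv_eq_of_mul_eq_one_right (by rw [mul_neg, hjj, neg_neg])
  have hij : i * j ∉ D := fun h => hijD (by
    rw [hinv, neg_mul]; exact hmneg (by rwa [neg_neg]))
  -- If i and j commuted, ij would have square 1 and so lie in D.
  have hanti : j * i = -(i * j) := by
    refine (hcomm j hj.1 i hi.1).resolve_left fun h => hij (hmem (Subgroup.mul_mem _ hi hj) ?_)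
    rw [(show Commute j i from h).mul_mul_mul_comm, hii, hjj]
    simp
  have hjij : j⁻¹ * (i * j) = -i := by
    rw [hjinv, neg_mul, ← mul_assoc, hanti, neg_mul, mul_assoc, hjj]; simp
  have hcoset : ∀ c ∈ commutant G f,
      c ∈ D ∨ i⁻¹ * c ∈ D ∨ j⁻¹ * c ∈ D ∨ (i * j)⁻¹ * c ∈ D := by
    intro c hc
    -- One order of the indices is enough, since D is closed under inverses.
    have hlt' : ∀ a b : Fin 4, a < b → (![1, i, j, i * j] a)⁻¹ * ![1, i, j, i * j] b ∉ D := by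
      intro a b hab h
      fin_cases a <;> fin_cases b <;> first | exact absurd hab (by decide) | skip
      · exact hiD (by simpa using h)
      · exact hjD (by simpa using h)
      · exact hij (by simpa using h)
      · exact hijD (by simpa using h)
      · exact hjD (by simpa using h)
      · have h' : j⁻¹ * (i * j) ∈ D := h
        rw [hjij] at h'
        exact hiD (hmneg h')
    obtain ⟨a, ha⟩ := exists_mem_coset_of_card_le (signCommutant_le G f) ![1, i, j, i * j]
      (fun a => by
        fin_cases a
        exacts [Subgroup.one_mem _, hi, hj, Subgroup.mul_mem _ hi hj])
      (fun a b h => by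
        rcases lt_trichotomy a b with hab | hab | hab
        · exact absurd h (hlt' a b hab)
        · exact hab
        · exact absurd (by simpa using D.inv_mem h) (hlt' b a hab)) hcard hc
    fin_cases a
    · exact Or.inl (by simpa using ha)
    · exact Or.inr (Or.inl ha)
    · exact Or.inr (Or.inr (Or.inl ha))
    · exact Or.inr (Or.inr (Or.inr ha))
  have hneg_one : toCorner hf ((-1 : Aˣ) : A) = -1 := by
    rw [Units.val_neg, map_neg, Units.val_one, toCorner_one]
  let q : QuaternionAlgebra.Basis hf.Corner (-1 : ℝ) 0 (-1) :=
    { i := toCorner hf i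
      j := toCorner hf j
      k := toCorner hf (i * j : Aˣ)
      i_mul_i := by
        rw [← toCorner_mul hf hi.2, ← Units.val_mul, hii, hneg_one]; simp
      j_mul_j := by
        rw [← toCorner_mul hf hj.2, ← Units.val_mul, hjj, hneg_one]; simp
      i_mul_j := by rw [← toCorner_mul hf hi.2, ← Units.val_mul]
      j_mul_i := by
        rw [← toCorner_mul hf hj.2, ← Units.val_mul, hanti, Units.val_neg, map_neg]; simp }
  let φ : Quaternion ℝ →ₐ[ℝ] hf.Corner := q.liftHom
  refine ⟨(AlgEquiv.ofBijective φ ⟨φ.toRingHom.injective, ?_⟩).symm⟩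
  have := corner_induction hf hspan hdich (LinearMap.range φ.toLinearMap) fun g hg => by
    rcases hcoset g hg with h | h | h | h
    · refine mem_range_of_coset hf φ (t := 1) (Subgroup.one_mem _) ⟨1, ?_⟩ (by simpa using h)
      simp [toCorner_one]
    · refine mem_range_of_coset hf φ hi ⟨⟨0, 1, 0, 0⟩, ?_⟩ h
      change q.lift _ = _
      simp [q, QuaternionAlgebra.Basis.lift]
    · refine mem_range_of_coset hf φ hj ⟨⟨0, 0, 1, 0⟩, ?_⟩ h
      change q.lift _ = _
      simp [q, QuaternionAlgebra.Basis.lift]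
    · refine mem_range_of_coset hf φ (Subgroup.mul_mem _ hi hj) ⟨⟨0, 0, 0, 1⟩, ?_⟩ h
      change q.lift _ = _
      simp [q, QuaternionAlgebra.Basis.lift]
  exact LinearMap.range_eq_top.1 this

end Quaternion

end Corner

end CliffordSpinor

namespace CliffordSpinor

variable (p q : ℕ)

/-! ### Signs of basis monomials. -/

section Monomials

/-- Each factor passed costs a sign except e_i itself; the count is added rather than subtracted,
which has the same parity and avoids subtraction in ℕ. -/
theorem genUnit_mul_list_prod (i : Fin (p + q)) (l : List (Fin (p + q))) :
    genUnit p q i * (l.map (genUnit p q)).prod =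
      (-1) ^ (l.length + l.count i) * ((l.map (genUnit p q)).prod * genUnit p q i) := by
  induction l with
  | nil => simp
  | cons a t ih =>
    rw [List.map_cons, List.prod_cons, ← mul_assoc]
    by_cases h : a = i
    · subst h
      have h2 : (-1 : (Cl p q)ˣ) ^ (t.length + 1 + (t.count a + 1)) =
          (-1) ^ (t.length + t.count a) := by
        rw [show t.length + 1 + (t.count a + 1) = t.length + t.count a + 2 by ring, pow_add]
        simp
      rw [List.count_cons_self, List.length_cons, h2]
      rcases neg_one_pow_eq_or (Cl p q)ˣ (t.length + t.count a) with h | h <;> rw [h] at ih ⊢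
      · rw [one_mul] at ih ⊢
        rw [mul_assoc, ih, ← mul_assoc, ih]
      · rw [neg_one_mul] at ih ⊢
        rw [mul_assoc, ih, mul_neg, ← mul_assoc, ih]
    · rw [genUnit_mul_comm p q (Ne.symm h), neg_mul, mul_assoc, ih, List.count_cons_of_ne h,
        List.length_cons, show t.length + 1 + t.count i = t.length + t.count i + 1 by ring, pow_succ]
      rcases neg_one_pow_eq_or (Cl p q)ˣ (t.length + t.count i) with h | h <;> simp [h, mul_assoc]

theorem genUnit_mul_monomial_comm (i : Fin (p + q)) (A : Finset (Fin (p + q))) :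
    genUnit p q i * monomial p q A =
      (-1) ^ (A.card + if i ∈ A then 1 else 0) * (monomial p q A * genUnit p q i) := by
  rw [monomial, genUnit_mul_list_prod, Finset.length_sort]
  congr 3
  split_ifs with h
  · exact List.count_eq_one_of_mem (A.sort_nodup _) (by simpa using h)
  · exact List.count_eq_zero.2 (by simpa using h)

/-- Bringing the two copies of the head together costs one sign per tail element, and these lengths
add up to the binomial coefficient. -/
theorem list_prod_mul_self (l : List (Fin (p + q))) (hl : l.Nodup) :
    ((l.map (genUnit p q)).prod : Cl p q) * ((l.map (genUnit p q)).prod : Cl p q) =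
      algebraMap ℝ (Cl p q) ((-1) ^ l.length.choose 2 * (l.map (weight p q)).prod) := by
  induction l with
  | nil => simp
  | cons a t ih =>
    rw [List.nodup_cons] at hl
    have h1 := congrArg Units.val (genUnit_mul_list_prod p q a t)
    rw [List.count_eq_zero.2 hl.1, add_zero] at h1
    simp only [Units.val_mul] at h1
    have h2 : (genUnit p q a : Cl p q) * genUnit p q a = algebraMap ℝ _ (weight p q a) :=
      gen_mul_self p q a
    have h3 := ih hl.2
    have h4 : (t.length + 1).choose 2 = t.length + t.length.choose 2 := by
      rw [Nat.choose_succ_succ' t.length 1, Nat.choose_one_right]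
    rw [List.map_cons, List.prod_cons, List.map_cons, List.prod_cons, List.length_cons, h4, pow_add]
    set x : Cl p q := (genUnit p q a : Cl p q)
    set y : Cl p q := (((t.map (genUnit p q)).prod : (Cl p q)ˣ) : Cl p q)
    have h5 : x * y * (x * y) = ((-1 : (Cl p q)ˣ) ^ t.length : (Cl p q)ˣ) * (x * x) * (y * y) := by
      have : y * x = ((-1 : (Cl p q)ˣ) ^ t.length : (Cl p q)ˣ) * (x * y) := by
        rcases neg_one_pow_eq_or (Cl p q)ˣ t.length with h | h <;> rw [h] at h1 ⊢ <;> simp [h1]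
      rw [mul_assoc x y, ← mul_assoc y x, this]
      rcases neg_one_pow_eq_or (Cl p q)ˣ t.length with h | h <;> simp [h, mul_assoc]
    rw [Units.val_mul, h5, h2, h3]
    simp only [Units.val_pow_eq_pow_val, Units.val_neg, Units.val_one, map_mul, map_pow, map_neg,
      map_one]
    rcases neg_one_pow_eq_or (Cl p q) t.length with h | h <;>
      rcases neg_one_pow_eq_or (Cl p q) (t.length.choose 2) with h' | h' <;> simp [h, h']

/-- The sign of the square of `e_A`. -/
noncomputable def sqSign (A : Finset (Fin (p + q))) : ℝ :=
  (-1) ^ A.card.choose 2 * ∏ i ∈ A, weight p q i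

theorem monomial_mul_self (A : Finset (Fin (p + q))) :
    (monomial p q A : Cl p q) * monomial p q A = algebraMap ℝ _ (sqSign p q A) := by
  rw [monomial, list_prod_mul_self p q _ (A.sort_nodup _), Finset.length_sort, sqSign,
    ← List.prod_toFinset _ (A.sort_nodup _), Finset.sort_toFinset]

theorem sqSign_eq_or (A : Finset (Fin (p + q))) : sqSign p q A = 1 ∨ sqSign p q A = -1 := by
  have h : ∏ i ∈ A, weight p q i = 1 ∨ ∏ i ∈ A, weight p q i = -1 := by
    rw [← mul_self_eq_one_iff, ← Finset.prod_mul_distrib]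
    exact Finset.prod_eq_one fun i _ => weight_mul_self p q i
  rw [sqSign]
  rcases neg_one_pow_eq_or ℝ (A.card.choose 2) with h1 | h1 <;> rcases h with h | h <;> simp [h, h1]

theorem unit_ne_neg (u : (Cl p q)ˣ) : u ≠ -u := fun h =>
  u.ne_zero (eq_zero_of_eq_neg (congrArg Units.val h))

theorem monomial_sq_eq_one_iff (A : Finset (Fin (p + q))) :
    monomial p q A * monomial p q A = 1 ↔ sqSign p q A = 1 := by
  have h := monomial_mul_self p q A
  constructor
  · intro h1
    refine (sqSign_eq_or p q A).resolve_right fun h2 => unit_ne_neg p q 1 ?_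
    rw [← Units.val_mul, h1, h2] at h
    ext
    simpa using h
  · intro h1
    ext
    rw [Units.val_mul, h, h1, map_one, Units.val_one]

theorem monomial_sq_eq_or (A : Finset (Fin (p + q))) :
    monomial p q A * monomial p q A = 1 ∨ monomial p q A * monomial p q A = -1 := by
  rcases sqSign_eq_or p q A with h | h
  · exact Or.inl ((monomial_sq_eq_one_iff p q A).2 h)
  · right
    ext
    rw [Units.val_mul, monomial_mul_self, h, map_neg, map_one, Units.val_neg, Units.val_one]

theorem involute_list_prod (l : List (Fin (p + q))) :
    CliffordAlgebra.involute ((l.map (genUnit p q)).prod : Cl p q) =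
      (-1) ^ l.length * ((l.map (genUnit p q)).prod : Cl p q) := by
  induction l with
  | nil => simp
  | cons a t ih =>
    have h : CliffordAlgebra.involute (genUnit p q a : Cl p q) = -(genUnit p q a : Cl p q) :=
      CliffordAlgebra.involute_ι _
    rw [List.map_cons, List.prod_cons, Units.val_mul, map_mul, ih, h, List.length_cons, pow_succ]
    rcases neg_one_pow_eq_or (Cl p q) t.length with h | h <;> simp [h]

theorem involute_monomial (A : Finset (Fin (p + q))) :
    CliffordAlgebra.involute (monomial p q A : Cl p q) =
      (-1) ^ A.card * (monomial p q A : Cl p q) := by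
  rw [monomial, involute_list_prod, Finset.length_sort]

theorem neg_one_pow_injective_mod {R : Type*} [Ring R] (h1 : (1 : R) ≠ -1) {a b : ℕ}
    (h : (-1 : R) ^ a = (-1) ^ b) : a % 2 = b % 2 := by
  rcases Nat.even_or_odd a with ha | ha <;> rcases Nat.even_or_odd b with hb | hb
  · rw [Nat.even_iff.1 ha, Nat.even_iff.1 hb]
  · rw [ha.neg_one_pow, hb.neg_one_pow] at h; exact absurd h h1
  · rw [ha.neg_one_pow, hb.neg_one_pow] at h; exact absurd h.symm h1
  · rw [Nat.odd_iff.1 ha, Nat.odd_iff.1 hb]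

/-- Up to sign a monomial still remembers its index set: the grade involution gives the parity of
|A|, and commuting past e_i then decides whether i lies in A. -/
theorem eq_of_monomial_eq_or {A B : Finset (Fin (p + q))}
    (h : monomial p q A = monomial p q B ∨ monomial p q A = -monomial p q B) : A = B := by
  have h1 : (1 : Cl p q) ≠ -1 := fun h => unit_ne_neg p q 1 (Units.ext h)
  have hcard : A.card % 2 = B.card % 2 := by
    apply neg_one_pow_injective_mod h1
    apply (monomial p q B).isUnit.mul_left_injective
    have hA := involute_monomial p q A
    have hB := involute_monomial p q B
    change (-1) ^ A.card * (monomial p q B : Cl p q) = (-1) ^ B.card * (monomial p q B : Cl p q)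
    rcases h with h | h <;> rw [h] at hA
    · rw [← hA, hB]
    · rw [Units.val_neg, map_neg, hB, mul_neg] at hA
      exact (neg_injective hA).symm
  ext i
  have hA := congrArg Units.val (genUnit_mul_monomial_comm p q i A)
  have hB := congrArg Units.val (genUnit_mul_monomial_comm p q i B)
  have hi : (A.card + if i ∈ A then 1 else 0) % 2 = (B.card + if i ∈ B then 1 else 0) % 2 := by
    apply neg_one_pow_injective_mod h1
    apply (monomial p q B * genUnit p q i).isUnit.mul_left_injective
    simp only [Units.val_mul, Units.val_pow_eq_pow_val, Units.val_neg, Units.val_one] at hA hB ⊢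
    rcases h with h | h <;> rw [h] at hA
    · rw [← hA, hB]
    · rw [Units.val_neg, mul_neg, hB, neg_mul, mul_neg] at hA
      exact (neg_injective hA).symm
  split_ifs at hi with h2 h3 h3 <;> first | omega | simp [h2, h3]

theorem exists_gen_anticommute {A : Finset (Fin (p + q))} (hA : A ≠ ∅)
    (h : A = Finset.univ → Even (p + q)) :
    ∃ i, genUnit p q i * monomial p q A = -(monomial p q A * genUnit p q i) := by
  -- For |A| even any i in A works; for |A| odd an index outside A is needed.
  have key : ∃ i, Odd (A.card + if i ∈ A then 1 else 0) := by
    rcases Nat.even_or_odd A.card with he | ho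
    · obtain ⟨i, hi⟩ := Finset.nonempty_iff_ne_empty.2 hA
      exact ⟨i, by simpa [hi] using he.add_one⟩
    · have : A ≠ Finset.univ := fun hu => by
        have he := h hu
        rw [hu, Finset.card_univ, Fintype.card_fin] at ho
        exact (Nat.not_even_iff_odd.2 ho) he
      obtain ⟨i, hi⟩ : ∃ i, i ∉ A := by
        by_contra! hall
        exact this (Finset.eq_univ_iff_forall.2 hall)
      exact ⟨i, by simpa [hi] using ho⟩
  obtain ⟨i, hi⟩ := key
  exact ⟨i, by rw [genUnit_mul_monomial_comm, hi.neg_one_pow, neg_one_mul]⟩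

end Monomials

/-! ### Structure of the vee group. -/

section VeeGroup

theorem monomial_mem (A : Finset (Fin (p + q))) : monomial p q A ∈ veeGroup p q := ⟨A, Or.inl rfl⟩

theorem monomial_empty : monomial p q ∅ = 1 := by simp [monomial]

theorem monomial_singleton (i : Fin (p + q)) : monomial p q {i} = genUnit p q i := by
  simp [monomial]

theorem genUnit_mem (i : Fin (p + q)) : genUnit p q i ∈ veeGroup p q :=
  monomial_singleton p q i ▸ monomial_mem p q {i}

theorem neg_one_mem : (-1 : (Cl p q)ˣ) ∈ veeGroup p q :=
  ⟨∅, Or.inr (by rw [monomial_empty])⟩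

theorem list_prod_commute_or {x : (Cl p q)ˣ} (l : List (Fin (p + q)))
    (h : ∀ i, x * genUnit p q i = genUnit p q i * x ∨ x * genUnit p q i = -(genUnit p q i * x)) :
    x * (l.map (genUnit p q)).prod = (l.map (genUnit p q)).prod * x ∨
      x * (l.map (genUnit p q)).prod = -((l.map (genUnit p q)).prod * x) := by
  induction l with
  | nil => simp
  | cons a t ih =>
    rw [List.map_cons, List.prod_cons, ← mul_assoc]
    rcases h a with h | h <;> rcases ih with h' | h' <;> simp [h, h', mul_assoc]

theorem veeGroup_commute_or : ∀ g ∈ veeGroup p q, ∀ h ∈ veeGroup p q,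
    g * h = h * g ∨ g * h = -(h * g) := by
  have key : ∀ A B, monomial p q A * monomial p q B = monomial p q B * monomial p q A ∨
      monomial p q A * monomial p q B = -(monomial p q B * monomial p q A) := fun A B => by
    refine list_prod_commute_or p q B.sort fun i => ?_
    rw [genUnit_mul_monomial_comm]
    rcases neg_one_pow_eq_or (Cl p q)ˣ (A.card + if i ∈ A then 1 else 0) with h | h <;> simp [h]
  rintro _ ⟨A, rfl | rfl⟩ _ ⟨B, rfl | rfl⟩ <;> rcases key A B with h | h <;> simp [h]

theorem veeGroup_sq_eq_or : ∀ g ∈ veeGroup p q, g * g = 1 ∨ g * g = -1 := by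
  rintro _ ⟨A, rfl | rfl⟩ <;> simpa using monomial_sq_eq_or p q A

/-- The group is closed under products, so the subalgebra it generates is merely its linear span. -/
theorem span_veeGroup :
    Submodule.span ℝ (Units.val '' (veeGroup p q : Set (Cl p q)ˣ)) = ⊤ := by
  let S : Submonoid (Cl p q) := (veeGroup p q).toSubmonoid.map (Units.coeHom (Cl p q))
  have hS : (S : Set (Cl p q)) = Units.val '' (veeGroup p q : Set (Cl p q)ˣ) := rfl
  have h1 : Algebra.adjoin ℝ (S : Set (Cl p q)) = ⊤ := by
    rw [eq_top_iff, ← CliffordAlgebra.adjoin_range_ι, Algebra.adjoin_le_iff]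
    rintro _ ⟨v, rfl⟩
    rw [pi_eq_sum_univ' v, map_sum]
    refine Subalgebra.sum_mem _ fun i _ => ?_
    rw [map_smul]
    refine Subalgebra.smul_mem _ (Algebra.subset_adjoin ?_) _
    refine ⟨genUnit p q i, genUnit_mem p q i, ?_⟩
    change CliffordAlgebra.ι (form p q) (Pi.single i 1) = _
    congr 1
  have h2 := Algebra.adjoin_eq_span ℝ (S : Set (Cl p q))
  rw [Submonoid.closure_eq S, h1, Algebra.top_toSubmodule] at h2
  rw [← hS, h2]

/-- The elements `e_A` and `-e_A`. -/
def signedMonomial : Finset (Fin (p + q)) ⊕ Finset (Fin (p + q)) → veeGroup p q :=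
  Sum.elim (fun A => ⟨monomial p q A, A, Or.inl rfl⟩) fun A => ⟨-monomial p q A, A, Or.inr rfl⟩

theorem signedMonomial_bijective : Function.Bijective (signedMonomial p q) := by
  constructor
  · rintro (A | A) (B | B) h <;> have h' := congrArg Subtype.val h <;>
      simp only [signedMonomial, Sum.elim_inl, Sum.elim_inr] at h'
    · rw [eq_of_monomial_eq_or p q (Or.inl h')]
    · have := eq_of_monomial_eq_or p q (Or.inr h')
      rw [this] at h'
      exact absurd h' (unit_ne_neg p q _)
    · have := eq_of_monomial_eq_or p q (Or.inr h'.symm)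
      rw [this] at h'
      exact absurd h'.symm (unit_ne_neg p q _)
    · rw [eq_of_monomial_eq_or p q (Or.inl (neg_injective h'))]
  · rintro ⟨g, A, rfl | rfl⟩
    exacts [⟨Sum.inl A, rfl⟩, ⟨Sum.inr A, rfl⟩]

instance finite_veeGroup : Finite (veeGroup p q) :=
  Finite.of_surjective _ (signedMonomial_bijective p q).2

theorem card_veeGroup : Nat.card (veeGroup p q) = 2 ^ (p + q + 1) := by
  rw [← Nat.card_eq_of_bijective _ (signedMonomial_bijective p q), Nat.card_sum,
    Nat.card_eq_fintype_card, Fintype.card_finset, Fintype.card_fin, pow_succ, mul_two]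

theorem transposition_veeGroup : ∀ g ∈ veeGroup p q, transposition p q (g : Cl p q) = (g⁻¹).1 := by
  have key : ∀ l : List (Fin (p + q)), transposition p q ((l.map (genUnit p q)).prod : Cl p q) =
      ((l.map (genUnit p q)).prod⁻¹).1 := fun l => by
    induction l with
    | nil => simp [transposition_one]
    | cons a t ih =>
      have h : transposition p q (genUnit p q a : Cl p q) = ((genUnit p q a)⁻¹).1 :=
        transposition_gen p q a
      rw [List.map_cons, List.prod_cons, Units.val_mul, transposition_mul, ih, h, mul_inv_rev,
        Units.val_mul]
  rintro _ ⟨A, rfl | rfl⟩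
  · exact key _
  · rw [Units.val_neg, map_neg, inv_neg, Units.val_neg, monomial, key]

theorem prod_weight : ∏ i, weight p q i = (-1) ^ q := by
  rw [Fin.prod_univ_add]
  simp [weight]

variable {p q}

/-- Only p - q ≡ 3 mod 4 remains, and the bound on p + q leaves a finite check. -/
theorem sqSign_univ (hpq : p + q ≤ 9) (hsimple : ¬ (p : ℤ) - q ≡ 1 [ZMOD 4])
    (hodd : Odd (p + q)) : sqSign p q Finset.univ = -1 := by
  rw [sqSign, prod_weight, Finset.card_univ, Fintype.card_fin]
  have hq : q ≤ 9 := by omega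
  have hp : p ≤ 9 := by omega
  rw [Int.ModEq] at hsimple
  rw [Nat.odd_iff] at hodd
  interval_cases q <;> interval_cases p <;>
    first | (exfalso; omega) | norm_num [Nat.choose]

/-- The only central monomials are 1 and, in odd dimension, the volume element; the latter squares
to -1 here, so it is not an involution. -/
theorem exists_anticommute (hpq : p + q ≤ 9) (hsimple : ¬ (p : ℤ) - q ≡ 1 [ZMOD 4])
    {h : (Cl p q)ˣ} (hG : h ∈ veeGroup p q) (hsq : h * h = 1) (h1 : h ≠ 1) (h2 : h ≠ -1) :
    ∃ g ∈ veeGroup p q, g * h = -(h * g) := by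
  obtain ⟨A, hA⟩ := hG
  have hA0 : A ≠ ∅ := by
    rintro rfl
    rw [monomial_empty] at hA
    exact hA.elim h1 h2
  have hAu : A = Finset.univ → Even (p + q) := fun hu => by
    by_contra hodd
    have h3 : monomial p q A * monomial p q A = 1 := by
      rcases hA with rfl | rfl <;> simpa using hsq
    rw [monomial_sq_eq_one_iff, hu,
      sqSign_univ hpq hsimple (Nat.not_even_iff_odd.1 hodd)] at h3
    norm_num at h3
  obtain ⟨i, hi⟩ := exists_gen_anticommute p q hA0 hAu
  refine ⟨genUnit p q i, genUnit_mem p q i, ?_⟩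
  rcases hA with rfl | rfl <;> simp [hi]

theorem monomial_univ_central (hodd : Odd (p + q)) (a : Cl p q) :
    (monomial p q Finset.univ : Cl p q) * a = a * monomial p q Finset.univ := by
  have hgen : ∀ i, Commute (monomial p q Finset.univ) (genUnit p q i) := fun i => by
    have h := genUnit_mul_monomial_comm p q i Finset.univ
    rw [Finset.card_univ, Fintype.card_fin, if_pos (Finset.mem_univ i),
      hodd.add_one.neg_one_pow, one_mul] at h
    exact h.symm
  have hG : ∀ g ∈ veeGroup p q, Commute (monomial p q Finset.univ) g := by
    have key : ∀ A, Commute (monomial p q Finset.univ) (monomial p q A) := fun A =>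
      Commute.list_prod_right _ _ fun x hx => by
        obtain ⟨i, -, rfl⟩ := List.mem_map.1 hx
        exact hgen i
    rintro _ ⟨A, rfl | rfl⟩
    exacts [key A, (key A).neg_right]
  have ha : a ∈ Submodule.span ℝ (Units.val '' (veeGroup p q : Set (Cl p q)ˣ)) :=
    span_veeGroup p q ▸ Submodule.mem_top
  induction ha using Submodule.span_induction with
  | zero => simp
  | add x y _ _ hx hy => rw [mul_add, add_mul, hx, hy]
  | smul c x _ hx => rw [mul_smul_comm, smul_mul_assoc, hx]
  | mem x hx =>
    obtain ⟨g, hg, rfl⟩ := hx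
    exact congrArg Units.val (hG g hg)

end VeeGroup

/-! ### The sum of the signs of squares. -/

section SignSum

/-- The real part recovers the sign (-1)^(s choose 2) from the multiplicative function i^s, so the
sum over all A becomes a product over the generators. -/
theorem one_sub_I_mul_pow (s : ℕ) : (1 - Complex.I) * Complex.I ^ s =
    (-1) ^ s.choose 2 * (1 - (-1) ^ s * Complex.I) := by
  induction s with
  | zero => simp
  | succ s ih =>
    rw [pow_succ, ← mul_assoc, ih, Nat.choose_succ_succ' s 1, Nat.choose_one_right, pow_add,
      pow_succ]
    rcases neg_one_pow_eq_or ℂ s with h | h <;> rw [h] <;> ring_nf <;>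
      simp only [Complex.I_sq] <;> ring

theorem sum_sqSign : ∑ A, sqSign p q A =
    ((1 - Complex.I) * ((1 + Complex.I) ^ p * (1 - Complex.I) ^ q)).re := by
  have h1 : ∏ i, (1 + Complex.I * (weight p q i : ℂ)) =
      (1 + Complex.I) ^ p * (1 - Complex.I) ^ q := by
    rw [Fin.prod_univ_add]
    simp [weight, sub_eq_add_neg]
  rw [← h1, Finset.prod_one_add, Finset.mul_sum, Complex.re_sum, Finset.powerset_univ]
  refine Finset.sum_congr rfl fun A _ => ?_
  rw [Finset.prod_mul_distrib, Finset.prod_const, ← mul_assoc, one_sub_I_mul_pow, sqSign,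
    ← Complex.ofReal_prod, Complex.re_mul_ofReal]
  congr 1
  rcases neg_one_pow_eq_or ℂ A.card with h | h <;>
    rcases Nat.even_or_odd (A.card.choose 2) with h' | h' <;>
    simp [h, h'.neg_one_pow]

variable {p q}

/-- The complex number has argument (p - q - 1)π/4, so its real part is negative in both residue
classes. -/
theorem sum_sqSign_neg (hpq : p + q ≤ 9)
    (h : ((p : ℤ) - q) % 8 = 4 ∨ ((p : ℤ) - q) % 8 = 6) : ∑ A, sqSign p q A < 0 := by
  rw [sum_sqSign]
  have hq : q ≤ 9 := by omega
  have hp : p ≤ 9 := by omega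
  interval_cases q <;> interval_cases p <;>
    first | (exfalso; omega) | norm_num [pow_succ, Complex.mul_re, Complex.mul_im]

end SignSum

end CliffordSpinor

namespace CliffordSpinor

/-! ### Counting elements of square one in a commutant. -/

section SquareCount

variable {A : Type*} [Ring A] [Algebra ℝ A] [Nontrivial A]

open Classical in
/-- The sign of the square of a unit `g` with `g ^ 2 = ± 1`. -/
noncomputable def unitSign (g : Aˣ) : ℝ := if g * g = 1 then 1 else -1

theorem one_ne_neg_one_units : (1 : Aˣ) ≠ -1 := fun h =>
  one_ne_zero (eq_zero_of_eq_neg (congrArg Units.val h))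

theorem unitSign_mul_of_anticommute {g h : Aˣ} (hg : g * g = 1 ∨ g * g = -1) (hh : h * h = 1)
    (hgh : g * h = -(h * g)) : unitSign (g * h) = -unitSign g := by
  have h1 : g * h * (g * h) = -(g * g) := by
    nth_rewrite 2 [hgh]
    rw [mul_neg, mul_assoc, ← mul_assoc h h, hh, one_mul]
  have h2 := one_ne_neg_one_units (A := A)
  rw [unitSign, unitSign, h1]
  rcases hg with hg | hg <;> simp [hg, h2.symm]

-- Restricting to the commutant of the h_i leaves the sum unchanged, because the discarded elements
-- cancel in pairs.
open Classical in
theorem sum_unitSign_commuting (G : Subgroup Aˣ) [Fintype G]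
    (hsq : ∀ g ∈ G, g * g = 1 ∨ g * g = -1)
    (hcomm : ∀ g ∈ G, ∀ h ∈ G, g * h = h * g ∨ g * h = -(h * g)) {ι : Type*} (h : ι → Aˣ)
    (hG : ∀ i, h i ∈ G) (hh : ∀ i, h i * h i = 1) (hc : ∀ i j, h i * h j = h j * h i)
    (l : List ι) :
    ∑ g ∈ Finset.univ.filter (fun g : G => ∀ i ∈ l, (g : Aˣ) * h i = h i * g), unitSign (g : Aˣ) =
      ∑ g : G, unitSign (g : Aˣ) := by
  induction l with
  | nil => simp
  | cons a t ih =>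
    rw [← ih, ← Finset.sum_filter_add_sum_filter_not
      (Finset.univ.filter fun g : G => ∀ i ∈ t, (g : Aˣ) * h i = h i * g)
      (fun g : G => (g : Aˣ) * h a = h a * g)]
    rw [Finset.filter_filter, Finset.filter_filter]
    have h0 : ∑ g ∈ Finset.univ.filter (fun g : G =>
        (∀ i ∈ t, (g : Aˣ) * h i = h i * g) ∧ ¬ (g : Aˣ) * h a = h a * g),
        unitSign (g : Aˣ) = 0 := by
      -- Multiplication by h_a flips the sign of the square of an element anticommuting with h_a,
      -- and respects the other commutation conditions because the h_i commute.
      refine Finset.sum_involution (fun g _ => g * ⟨h a, hG a⟩) ?_ ?_ ?_ ?_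
      · intro g hg
        rw [Finset.mem_filter] at hg
        have h1 := (hcomm g g.2 _ (hG a)).resolve_left hg.2.2
        change unitSign (g : Aˣ) + unitSign ((g : Aˣ) * h a) = 0
        rw [unitSign_mul_of_anticommute (hsq g g.2) (hh a) h1, add_neg_cancel]
      · intro g hg _ hga
        rw [Finset.mem_filter] at hg
        have h1 : h a = 1 := congrArg Subtype.val (mul_eq_left.1 hga)
        exact hg.2.2 (by rw [h1, mul_one, one_mul])
      · intro g hg
        rw [Finset.mem_filter] at hg ⊢
        refine ⟨Finset.mem_univ _, fun i hi => ?_, fun h1 => hg.2.2 ?_⟩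
        · change (g : Aˣ) * h a * h i = h i * (g * h a)
          rw [mul_assoc, hc a i, ← mul_assoc, hg.2.1 i hi, mul_assoc]
        · have h2 : (g : Aˣ) * h a * h a = h a * (g * h a) := h1
          rw [← mul_assoc] at h2
          exact mul_right_cancel h2
      · intro g _
        refine Subtype.ext ?_
        change (g : Aˣ) * h a * h a = g
        rw [mul_assoc, hh, mul_one]
    rw [h0, add_zero]
    refine Finset.sum_congr ?_ fun _ _ => rfl
    ext g
    simp [and_comm]

open Classical in
theorem two_mul_card_lt_of_sum_neg {A : Type*} [Ring A] (G C : Subgroup Aˣ) [Fintype G] (hC : C ≤ G)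
    (h : ∑ g ∈ Finset.univ.filter (fun g : G => (g : Aˣ) ∈ C), unitSign (g : Aˣ) < 0) :
    2 * Nat.card {g // g ∈ C ∧ g * g = 1} < Nat.card C := by
  have key : ∀ P : Aˣ → Prop, (∀ g, P g → g ∈ G) →
      Nat.card {g // P g} = (Finset.univ.filter fun g : G => P g).card := fun P hP => by
    rw [← Nat.card_congr (Equiv.subtypeSubtypeEquivSubtype (hP _)), Nat.card_eq_fintype_card,
      Fintype.card_subtype]
  rw [key _ fun g hg => hC hg.1, show Nat.card C = Nat.card {g // g ∈ C} from rfl,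
    key _ fun g hg => hC hg]
  have h1 : ∀ g : G, unitSign (g : Aˣ) = 2 * (if (g : Aˣ) * g = 1 then 1 else 0) - 1 := fun g => by
    rw [unitSign]; split_ifs <;> norm_num
  simp only [h1] at h
  rw [Finset.sum_sub_distrib, ← Finset.mul_sum, Finset.sum_boole, Finset.sum_const, nsmul_one,
    sub_neg, Finset.filter_filter] at h
  norm_cast at h
  convert h
  rw [← Subgroup.coe_mul, OneMemClass.coe_eq_one]

end SquareCount

/-! ### The idempotent, its commutants and its conjugates. -/

namespace IdempotentData

variable {p q : ℕ} (D : IdempotentData p q)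

theorem idempotent_eq_list_prod :
    D.idempotent = ((List.finRange (spinorExponent p q)).map D.factor).prod := by
  rw [idempotent, List.ofFn_eq_map]

theorem factor_mul_idempotent (i) : D.factor i * D.idempotent = D.idempotent := by
  have key : ∀ l : List (Fin (spinorExponent p q)), i ∈ l →
      D.factor i * (l.map D.factor).prod = (l.map D.factor).prod := by
    intro l
    induction l with
    | nil => simp
    | cons a t ih =>
      intro h
      rw [List.map_cons, List.prod_cons, ← mul_assoc]
      rcases List.mem_cons.1 h with rfl | h
      · rw [(D.factor_mul_self i).eq]
      · rw [(D.factor_commute i a).eq, mul_assoc, ih h]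
  rw [idempotent_eq_list_prod]
  exact key _ (List.mem_finRange i)

/-- The involution `± e_{A_i}`. -/
def signedInvolution (i : Fin (spinorExponent p q)) : Cl p q :=
  ((D.sign i : ℤ) : ℝ) • (monomial p q (D.index i) : Cl p q)

theorem sign_eq_or (i) : ((D.sign i : ℤ) : ℝ) = 1 ∨ ((D.sign i : ℤ) : ℝ) = -1 := by
  rcases Int.units_eq_one_or (D.sign i) with h | h <;> simp [h]

theorem signedInvolution_eq_or (i) : D.signedInvolution i = monomial p q (D.index i) ∨
    D.signedInvolution i = -(monomial p q (D.index i) : Cl p q) := by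
  rcases D.sign_eq_or i with h | h <;> simp [signedInvolution, h]

theorem signedInvolution_mul_idempotent (i) :
    D.signedInvolution i * D.idempotent = D.idempotent := by
  have h : (2⁻¹ : ℝ) • (1 + D.signedInvolution i) * D.idempotent = D.idempotent :=
    D.factor_mul_idempotent i
  have h2 := congrArg (fun x => (2 : ℝ) • x) h
  simp only [smul_mul_assoc, smul_smul] at h2
  rw [mul_inv_cancel₀ two_ne_zero, one_smul, add_mul, one_mul, two_smul] at h2
  exact add_left_cancel h2

theorem monomial_mul_idempotent (i) :
    (monomial p q (D.index i) : Cl p q) * D.idempotent = D.idempotent ∨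
      (monomial p q (D.index i) : Cl p q) * D.idempotent = -D.idempotent := by
  have h1 := D.signedInvolution_mul_idempotent i
  rcases D.signedInvolution_eq_or i with h | h <;> rw [h] at h1
  · exact Or.inl h1
  · rw [neg_mul] at h1
    exact Or.inr (neg_eq_iff_eq_neg.1 h1)

theorem mem_commutant {g : (Cl p q)ˣ} (hg : g ∈ veeGroup p q)
    (h : ∀ i, g * monomial p q (D.index i) = monomial p q (D.index i) * g) :
    g ∈ commutant (veeGroup p q) D.idempotent := by
  refine ⟨hg, ?_⟩
  have : Commute (g : Cl p q) D.idempotent := by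
    rw [idempotent_eq_list_prod]
    refine Commute.list_prod_right _ _ fun x hx => ?_
    obtain ⟨i, -, rfl⟩ := List.mem_map.1 hx
    have h1 : Commute (g : Cl p q) (monomial p q (D.index i) : Cl p q) := congrArg Units.val (h i)
    exact ((Commute.one_right _).add_right (h1.smul_right _)).smul_right _
  exact this

theorem monomial_mem_commutant (i) :
    monomial p q (D.index i) ∈ commutant (veeGroup p q) D.idempotent :=
  D.mem_commutant (monomial_mem p q _) fun j => D.commute i j

/-- Inserting e_{A_i} on either side of g yields the same sign times f g f, while anticommutation
makes the two results opposite. -/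
theorem idempotent_mul_mul_idempotent {g : (Cl p q)ˣ} (hg : g ∈ veeGroup p q) {i}
    (h : g * monomial p q (D.index i) ≠ monomial p q (D.index i) * g) :
    D.idempotent * g * D.idempotent = 0 := by
  have h1 := congrArg Units.val
    ((veeGroup_commute_or p q g hg _ (monomial_mem p q (D.index i))).resolve_left h)
  rw [Units.val_neg, Units.val_mul, Units.val_mul] at h1
  have hcomm := (D.monomial_mem_commutant i).2
  apply eq_zero_of_eq_neg
  have h2 : D.idempotent * (g * (monomial p q (D.index i) : Cl p q)) * D.idempotent =
      -(D.idempotent * ((monomial p q (D.index i) : Cl p q) * g) * D.idempotent) := by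
    rw [h1, mul_neg, neg_mul]
  rw [← mul_assoc, mul_assoc, ← mul_assoc D.idempotent (monomial p q (D.index i) : Cl p q),
    ← hcomm] at h2
  rcases D.monomial_mul_idempotent i with h | h <;> rw [h] at h2
  · exact h2
  · simpa using h2.symm

theorem idempotent_mul_mul_eq_zero (g) (hg : g ∈ veeGroup p q)
    (h : g ∉ commutant (veeGroup p q) D.idempotent) : D.idempotent * g * D.idempotent = 0 := by
  by_contra h0
  refine h (D.mem_commutant hg fun i => ?_)
  by_contra hi
  exact h0 (D.idempotent_mul_mul_idempotent hg hi)

theorem mem_commutant_iff (h0 : D.idempotent ≠ 0) {g : (Cl p q)ˣ} (hg : g ∈ veeGroup p q) :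
    g ∈ commutant (veeGroup p q) D.idempotent ↔
      ∀ i, g * monomial p q (D.index i) = monomial p q (D.index i) * g := by
  refine ⟨fun h i => ?_, D.mem_commutant hg⟩
  by_contra hi
  have h1 := D.idempotent_mul_mul_idempotent hg hi
  rw [← h.2, mul_assoc, D.isIdempotentElem.eq] at h1
  exact h0 (g.isUnit.mul_right_eq_zero.1 h1)

theorem closure_le_signCommutant :
    Subgroup.closure (Set.range fun i => monomial p q (D.index i)) ≤
      signCommutant (veeGroup p q) D.idempotent := by
  rw [Subgroup.closure_le]
  rintro _ ⟨i, rfl⟩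
  exact ⟨D.monomial_mem_commutant i, D.monomial_mul_idempotent i⟩

/-- The group E generated by the e_{A_i} and its negative both lie in the sign commutant, and they
are disjoint since -1 is not in E. -/
theorem two_pow_le_card_signCommutant :
    2 ^ (spinorExponent p q + 1) ≤ Nat.card (signCommutant (veeGroup p q) D.idempotent) := by
  set E := Subgroup.closure (Set.range fun i => monomial p q (D.index i))
  have hfin : Finite (signCommutant (veeGroup p q) D.idempotent) :=
    Finite.of_injective _ (Subgroup.inclusion_injective (signCommutant_le _ _))
  have hneg : ∀ g ∈ signCommutant (veeGroup p q) D.idempotent,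
      -g ∈ signCommutant (veeGroup p q) D.idempotent := fun g hg => by
    have h1 : (-1 : (Cl p q)ˣ) ∈ signCommutant (veeGroup p q) D.idempotent :=
      ⟨⟨neg_one_mem p q, by simp⟩, by simp⟩
    simpa using mul_mem h1 hg
  let F : E ⊕ E → signCommutant (veeGroup p q) D.idempotent :=
    Sum.elim (fun e => ⟨e, D.closure_le_signCommutant e.2⟩)
      fun e => ⟨-e, hneg _ (D.closure_le_signCommutant e.2)⟩
  have key : ∀ d e : E, (d : (Cl p q)ˣ) ≠ -e := fun d e h => D.neg_one_notMem <| by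
    have h1 : (-1 : (Cl p q)ˣ) = d * (e : (Cl p q)ˣ)⁻¹ := by rw [h]; simp
    rw [h1]
    exact E.mul_mem d.2 (E.inv_mem e.2)
  have hF : Function.Injective F := by
    rintro (d | d) (e | e) h <;> have h' := congrArg (fun x => x.1) h
    · exact congrArg Sum.inl (Subtype.ext h')
    · exact absurd h' (key d e)
    · exact absurd h'.symm (key e d)
    · exact congrArg Sum.inr (Subtype.ext (neg_injective h'))
  have h1 := Nat.card_le_card_of_injective F hF
  have hE : Nat.card E = 2 ^ spinorExponent p q := D.card_group
  have hEfin : Finite E := Nat.finite_of_card_ne_zero (by rw [hE]; positivity)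
  rwa [Nat.card_sum, hE, ← two_mul, ← pow_succ'] at h1

theorem list_prod_signedInvolution (s : List (Fin (spinorExponent p q))) :
    (s.map D.signedInvolution).prod = ((s.map fun i => monomial p q (D.index i)).prod : Cl p q) ∨
      (s.map D.signedInvolution).prod =
        -((s.map fun i => monomial p q (D.index i)).prod : Cl p q) := by
  induction s with
  | nil => simp
  | cons a t ih =>
    rw [List.map_cons, List.prod_cons, List.map_cons, List.prod_cons, Units.val_mul]
    rcases D.signedInvolution_eq_or a with h | h <;> rcases ih with h' | h' <;> simp [h, h']

theorem list_prod_factor (l : List (Fin (spinorExponent p q))) : (l.map D.factor).prod =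
    (2⁻¹ : ℝ) ^ l.length • (l.map fun i => 1 + D.signedInvolution i).prod := by
  induction l with
  | nil => simp
  | cons a t ih =>
    have h : D.factor a = (2⁻¹ : ℝ) • (1 + D.signedInvolution a) := rfl
    rw [List.map_cons, List.prod_cons, List.map_cons, List.prod_cons, ih, h, smul_mul_smul_comm,
      List.length_cons, pow_succ']

variable (hpq : p + q ≤ 9) (hsimple : ¬ (p : ℤ) - q ≡ 1 [ZMOD 4])

include hpq hsimple

/-- Up to sign the product is an involution in the vee group; independence and the exclusion of -1
keep it away from ±1, so something anticommutes with it. -/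
theorem conjSum_list_prod [Fintype (veeGroup p q)] {s : List (Fin (spinorExponent p q))}
    (hs : s.Nodup) (hne : s ≠ []) : conjSum (veeGroup p q) (s.map D.signedInvolution).prod = 0 := by
  set u := (s.map fun i => monomial p q (D.index i)).prod
  have hE : u ∈ Subgroup.closure (Set.range fun i => monomial p q (D.index i)) :=
    Subgroup.list_prod_mem _ fun x hx => by
      obtain ⟨i, -, rfl⟩ := List.mem_map.1 hx
      exact Subgroup.subset_closure ⟨i, rfl⟩
  have hG : u ∈ veeGroup p q := (D.closure_le_signCommutant hE).1.1
  have h1 : u ≠ 1 := list_prod_ne_one_of_card_closure _ D.commute D.square D.card_group hs hne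
  have h2 : u ≠ -1 := fun h => D.neg_one_notMem (h ▸ hE)
  have hsq : u * u = 1 := by
    have key : ∀ t : List (Fin (spinorExponent p q)),
        (t.map fun i => monomial p q (D.index i)).prod *
          (t.map fun i => monomial p q (D.index i)).prod = 1 := fun t => by
      induction t with
      | nil => simp
      | cons a t ih =>
        have hc : Commute (monomial p q (D.index a))
            (t.map fun i => monomial p q (D.index i)).prod :=
          Commute.list_prod_right _ _ fun x hx => by
            obtain ⟨i, -, rfl⟩ := List.mem_map.1 hx
            exact D.commute a i
        rw [List.map_cons, List.prod_cons, hc.symm.mul_mul_mul_comm, ih, D.square, one_mul]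
    exact key s
  obtain ⟨g, hg, hgu⟩ := exists_anticommute hpq hsimple hG hsq h1 h2
  have hgu' := congrArg Units.val hgu
  rw [Units.val_neg, Units.val_mul, Units.val_mul] at hgu'
  refine conjSum_eq_zero _ hg ?_
  rcases D.list_prod_signedInvolution s with h | h <;> rw [h]
  · exact hgu'
  · rw [mul_neg, neg_mul, neg_inj]
    exact hgu'

theorem conjSum_idempotent [Fintype (veeGroup p q)] : conjSum (veeGroup p q) D.idempotent =
    algebraMap ℝ (Cl p q) ((2⁻¹ : ℝ) ^ spinorExponent p q * Nat.card (veeGroup p q)) := by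
  rw [idempotent_eq_list_prod, list_prod_factor, map_smul, List.length_finRange, map_mul,
    ← Algebra.smul_def, ← conjSum_one]
  congr 1
  have := map_mul_list_prod_one_add (conjSum (veeGroup p q)) D.signedInvolution
    (List.finRange (spinorExponent p q)) 1 fun s hs hne => by
      rw [one_mul]
      exact D.conjSum_list_prod hpq hsimple (hs.nodup (List.nodup_finRange _)) hne
  rwa [one_mul] at this

end IdempotentData

end CliffordSpinor

namespace CliffordSpinor

theorem mem_stabilizer_iff {p q : ℕ} {f : Cl p q} {g : veeGroup p q} :
    g ∈ stabilizer p q f ↔ (g : (Cl p q)ˣ) ∈ commutant (veeGroup p q) f := by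
  change ((g : (Cl p q)ˣ) : Cl p q) * f * ((g : (Cl p q)ˣ)⁻¹ : (Cl p q)ˣ) = f ↔ _
  rw [Units.mul_inv_eq_iff_eq_mul]
  exact ⟨fun h => ⟨g.2, h⟩, fun h => h.2⟩

theorem card_stabilizer {p q : ℕ} (f : Cl p q) :
    Nat.card (stabilizer p q f) = Nat.card (commutant (veeGroup p q) f) :=
  Nat.card_congr
    { toFun := fun g => ⟨g.1.1, mem_stabilizer_iff.1 g.2⟩
      invFun := fun g => ⟨⟨g.1, g.2.1⟩, mem_stabilizer_iff.2 g.2⟩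
      left_inv := fun _ => rfl
      right_inv := fun _ => rfl }

/-! ### Transversals of the stabilizer and the resulting counts. -/

namespace IdempotentData

variable {p q : ℕ} (D : IdempotentData p q) {N : ℕ} {m : Fin N → veeGroup p q}
  (hm : Function.Bijective
      fun i => (QuotientGroup.mk (m i) : veeGroup p q ⧸ stabilizer p q D.idempotent))

include hm

theorem card_mul_card_stabilizer :
    N * Nat.card (stabilizer p q D.idempotent) = Nat.card (veeGroup p q) := by
  rw [← Nat.card_eq_of_bijective _ (transversal_bijective _ m hm), Nat.card_prod, Nat.card_fin]

theorem conjugates_orthogonal (i j : Fin N) (hij : i ≠ j) :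
    D.idempotent * ((m i : (Cl p q)ˣ)⁻¹).1 * (m j : (Cl p q)ˣ).1 * D.idempotent = 0 := by
  have h := D.idempotent_mul_mul_eq_zero ((m i)⁻¹ * m j : veeGroup p q) ((m i)⁻¹ * m j).2
    fun hmem => hij (hm.1 (QuotientGroup.eq.2 (mem_stabilizer_iff.2 hmem)))
  simpa [mul_assoc] using h

theorem card_smul_sum_conjugates [Fintype (veeGroup p q)] :
    (Nat.card (stabilizer p q D.idempotent) : ℝ) •
      ∑ i, (m i : (Cl p q)ˣ).1 * D.idempotent * ((m i : (Cl p q)ˣ)⁻¹).1 =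
      conjSum (veeGroup p q) D.idempotent := by
  classical
  have : Fintype (stabilizer p q D.idempotent) := Fintype.ofFinite _
  rw [conjSum_apply, ← (transversal_bijective _ m hm).sum_comp
    fun g : veeGroup p q => (g : (Cl p q)ˣ).1 * D.idempotent * ((g : (Cl p q)ˣ)⁻¹).1,
    Fintype.sum_prod_type, Finset.smul_sum]
  refine Finset.sum_congr rfl fun i _ => ?_
  have key : ∀ c : stabilizer p q D.idempotent,
      (((m i * c : veeGroup p q) : (Cl p q)ˣ) : Cl p q) * D.idempotent *
        (((m i * c : veeGroup p q) : (Cl p q)ˣ)⁻¹).1 =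
      (m i : (Cl p q)ˣ).1 * D.idempotent * ((m i : (Cl p q)ˣ)⁻¹).1 := fun c => by
    have hc : ((c : veeGroup p q) : (Cl p q)ˣ).1 * D.idempotent *
        (((c : veeGroup p q) : (Cl p q)ˣ)⁻¹).1 = D.idempotent := c.2
    rw [Subgroup.coe_mul, mul_inv_rev, Units.val_mul, Units.val_mul]
    calc _ = (m i : (Cl p q)ˣ).1 * (((c : veeGroup p q) : (Cl p q)ˣ).1 * D.idempotent *
          (((c : veeGroup p q) : (Cl p q)ˣ)⁻¹).1) * ((m i : (Cl p q)ˣ)⁻¹).1 := by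
            simp only [mul_assoc]
      _ = _ := by rw [hc]
  simp only [key]
  rw [Finset.sum_const, Finset.card_univ, ← Nat.card_eq_fintype_card, Nat.cast_smul_eq_nsmul]

variable (hpq : p + q ≤ 9) (hsimple : ¬ (p : ℤ) - q ≡ 1 [ZMOD 4])

include hpq hsimple

theorem card_eq_and_sum_conjugates : N = 2 ^ spinorExponent p q ∧
    ∑ i, (m i : (Cl p q)ˣ).1 * D.idempotent * ((m i : (Cl p q)ˣ)⁻¹).1 = 1 := by
  have : Fintype (veeGroup p q) := Fintype.ofFinite _
  set S := ∑ i, (m i : (Cl p q)ˣ).1 * D.idempotent * ((m i : (Cl p q)ˣ)⁻¹).1 with hS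
  have hG : N * Nat.card (stabilizer p q D.idempotent) ≠ 0 := by
    rw [D.card_mul_card_stabilizer hm, card_veeGroup]; positivity
  have hN : (N : ℝ) ≠ 0 := Nat.cast_ne_zero.2 (left_ne_zero_of_mul hG)
  have hC : (Nat.card (stabilizer p q D.idempotent) : ℝ) ≠ 0 :=
    Nat.cast_ne_zero.2 (right_ne_zero_of_mul hG)
  have hval : S = algebraMap ℝ (Cl p q) ((2⁻¹ : ℝ) ^ spinorExponent p q * N) := by
    have h := D.card_smul_sum_conjugates hm
    rw [D.conjSum_idempotent hpq hsimple, ← D.card_mul_card_stabilizer hm, Nat.cast_mul,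
      ← mul_assoc, mul_comm _ (Nat.card (stabilizer p q D.idempotent) : ℝ), map_mul,
      ← Algebra.smul_def] at h
    exact smul_right_injective _ hC h
  -- A sum of pairwise orthogonal idempotents is idempotent.
  have hidem : S * S = S := by
    nth_rewrite 1 [hS]
    rw [Finset.sum_mul]
    refine Finset.sum_congr rfl fun i _ => ?_
    rw [hS, Finset.mul_sum, Finset.sum_eq_single i]
    · have := D.isIdempotentElem.eq
      simp only [mul_assoc]
      rw [Units.inv_mul_cancel_left, ← mul_assoc D.idempotent D.idempotent, this]
    · intro j _ hj
      have := D.conjugates_orthogonal hm i j hj.symm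
      calc _ = (m i : (Cl p q)ˣ).1 * (D.idempotent * ((m i : (Cl p q)ˣ)⁻¹).1 *
            (m j : (Cl p q)ˣ).1 * D.idempotent) * ((m j : (Cl p q)ˣ)⁻¹).1 := by
              simp only [mul_assoc]
        _ = 0 := by rw [this, mul_zero, zero_mul]
    · simp
  -- A nonzero real idempotent is 1; this determines N and the sum together.
  have hc : ((2⁻¹ : ℝ) ^ spinorExponent p q * N) = 1 := by
    rw [hval, ← map_mul] at hidem
    have h1 := (algebraMap ℝ (Cl p q)).injective hidem
    exact (mul_eq_right₀ (mul_ne_zero (by positivity) hN)).1 h1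
  refine ⟨?_, by rw [hval, hc, map_one]⟩
  rw [inv_pow, inv_mul_eq_one₀ (by positivity)] at hc
  exact_mod_cast hc.symm

theorem idempotent_ne_zero : D.idempotent ≠ 0 := fun h0 => by
  have h := (D.card_eq_and_sum_conjugates hm hpq hsimple).2
  simp [h0] at h

theorem card_commutant_mul : Nat.card (commutant (veeGroup p q) D.idempotent) *
    2 ^ spinorExponent p q = 2 ^ (p + q + 1) := by
  have h := D.card_mul_card_stabilizer hm
  rwa [card_stabilizer, card_veeGroup, (D.card_eq_and_sum_conjugates hm hpq hsimple).1,
    mul_comm] at h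

theorem card_commutant_le {r : ℕ} (hr : p + q = 2 * spinorExponent p q + r) :
    Nat.card (commutant (veeGroup p q) D.idempotent) ≤
      2 ^ r * Nat.card (signCommutant (veeGroup p q) D.idempotent) := by
  have h1 := D.card_commutant_mul hm hpq hsimple
  have h2 : Nat.card (commutant (veeGroup p q) D.idempotent) =
      2 ^ r * 2 ^ (spinorExponent p q + 1) := by
    refine Nat.eq_of_mul_eq_mul_right (Nat.two_pow_pos (spinorExponent p q)) ?_
    rw [h1, hr, ← pow_add, ← pow_add]
    congr 1
    ring
  rw [h2]
  exact Nat.mul_le_mul_left _ D.two_pow_le_card_signCommutant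

theorem two_mul_card_sq_lt
    (hmod : ((p : ℤ) - q) % 8 = 4 ∨ ((p : ℤ) - q) % 8 = 6) :
    2 * Nat.card {g // g ∈ commutant (veeGroup p q) D.idempotent ∧ g * g = 1} <
      Nat.card (commutant (veeGroup p q) D.idempotent) := by
  classical
  have : Fintype (veeGroup p q) := Fintype.ofFinite _
  refine two_mul_card_lt_of_sum_neg (veeGroup p q) _ (fun _ h => h.1) ?_
  have h0 := D.idempotent_ne_zero hm hpq hsimple
  have h1 := sum_unitSign_commuting (veeGroup p q) (veeGroup_sq_eq_or p q)
    (veeGroup_commute_or p q) (fun i => monomial p q (D.index i))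
    (fun i => monomial_mem p q _) D.square (fun i j => D.commute i j) (List.finRange _)
  have h2 : ∑ g : veeGroup p q, unitSign (g : (Cl p q)ˣ) = 2 * ∑ A, sqSign p q A := by
    rw [← (signedMonomial_bijective p q).sum_comp fun g => unitSign (g : (Cl p q)ˣ),
      Fintype.sum_sum_type, two_mul]
    have key : ∀ A, unitSign (monomial p q A) = sqSign p q A := fun A => by
      simp only [unitSign, monomial_sq_eq_one_iff]
      rcases sqSign_eq_or p q A with h | h <;> rw [h] <;> norm_num
    have key' : ∀ A, unitSign (-monomial p q A) = sqSign p q A := fun A => by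
      rw [← key, unitSign, unitSign, neg_mul_neg]
    exact congrArg₂ _ (Finset.sum_congr rfl fun A _ => key A)
      (Finset.sum_congr rfl fun A _ => key' A)
  have h3 := sum_sqSign_neg hpq hmod
  have h4 : ∑ g ∈ Finset.univ.filter (fun g : veeGroup p q =>
      (g : (Cl p q)ˣ) ∈ commutant (veeGroup p q) D.idempotent), unitSign (g : (Cl p q)ˣ) =
      2 * ∑ A, sqSign p q A := by
    rw [← h2, ← h1]
    refine Finset.sum_congr ?_ fun _ _ => rfl
    ext g
    simp [D.mem_commutant_iff h0 g.2]
  rw [h4]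
  linarith

end IdempotentData

/-! ### Square roots of -1 under conjugation, and the main theorem. -/

theorem complex_star_eq_neg_of_sq_eq_neg_one (x : ℂ) (h : x * x = -1) : star x = -x := by
  have hI : x * x = Complex.I * Complex.I := by rw [h, Complex.I_mul_I]
  rcases mul_self_eq_mul_self_iff.1 hI with rfl | rfl <;> simp

theorem quaternion_star_eq_neg_of_sq_eq_neg_one (x : Quaternion ℝ) (h : x * x = -1) :
    star x = -x := by
  have h0 := congrArg (fun y => y.re) h
  have h1 := congrArg (fun y => y.imI) h
  have h2 := congrArg (fun y => y.imJ) h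
  have h3 := congrArg (fun y => y.imK) h
  simp only [Quaternion.re_mul, Quaternion.imI_mul, Quaternion.imJ_mul, Quaternion.imK_mul,
    Quaternion.re_neg, Quaternion.imI_neg, Quaternion.imJ_neg, Quaternion.imK_neg,
    Quaternion.re_one, Quaternion.imI_one, Quaternion.imJ_one, Quaternion.imK_one] at h0 h1 h2 h3
  -- A nonzero real part would kill the imaginary parts, leaving a real square equal to -1.
  have hre : x.re = 0 := by
    by_contra hre
    have e1 : x.imI = 0 := by
      apply mul_left_cancel₀ hre; linarith
    have e2 : x.imJ = 0 := by
      apply mul_left_cancel₀ hre; linarith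
    have e3 : x.imK = 0 := by
      apply mul_left_cancel₀ hre; linarith
    rw [e1, e2, e3] at h0
    nlinarith [mul_self_nonneg x.re]
  ext <;> simp [hre]

end CliffordSpinor

theorem mainTheorem1 (p q : ℕ) (hpq : p + q ≤ 9) (hsimple : ¬ (p : ℤ) - q ≡ 1 [ZMOD 4])
    (D : IdempotentData p q) (N : ℕ) (m : Fin N → veeGroup p q)
    (hm : Function.Bijective
      fun i => (QuotientGroup.mk (m i) : veeGroup p q ⧸ stabilizer p q D.idempotent)) :
    N = 2 ^ spinorExponent p q ∧
    ∃ b : Module.Basis (Fin N) D.isIdempotentElem.Cornerᵐᵒᵖ (SpinorSpace D.isIdempotentElem),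
      (∀ i, (b i : Cl p q) = ((m i : (Cl p q)ˣ) : Cl p q) * D.idempotent) ∧
      ((((p : ℤ) - q) % 8 = 0 ∨ ((p : ℤ) - q) % 8 = 1 ∨ ((p : ℤ) - q) % 8 = 2) →
        Nonempty (D.isIdempotentElem.Corner ≃ₐ[ℝ] ℝ) ∧
        ∀ u : Cl p q,
          spinorMatrix D.isIdempotentElem b (transposition p q u) =
            (spinorMatrix D.isIdempotentElem b u).transpose) ∧
      ((((p : ℤ) - q) % 8 = 3 ∨ ((p : ℤ) - q) % 8 = 7) →
        Nonempty (D.isIdempotentElem.Corner ≃ₐ[ℝ] ℂ) ∧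
        ∀ (φ : D.isIdempotentElem.Corner ≃ₐ[ℝ] ℂ) (u : Cl p q),
          (spinorMatrix D.isIdempotentElem b (transposition p q u)).map φ =
            ((spinorMatrix D.isIdempotentElem b u).map φ).conjTranspose) ∧
      ((((p : ℤ) - q) % 8 = 4 ∨ ((p : ℤ) - q) % 8 = 5 ∨ ((p : ℤ) - q) % 8 = 6) →
        Nonempty (D.isIdempotentElem.Corner ≃ₐ[ℝ] Quaternion ℝ) ∧
        ∀ (φ : D.isIdempotentElem.Corner ≃ₐ[ℝ] Quaternion ℝ) (u : Cl p q),
          (spinorMatrix D.isIdempotentElem b (transposition p q u)).map φ =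
            ((spinorMatrix D.isIdempotentElem b u).map φ).conjTranspose) := by
  obtain ⟨hN, hsum⟩ := D.card_eq_and_sum_conjugates hm hpq hsimple
  have horth := D.conjugates_orthogonal hm
  have h0 := D.idempotent_ne_zero hm hpq hsimple
  have hf := D.isIdempotentElem
  have hspan := span_veeGroup p q
  have hsq := veeGroup_sq_eq_or p q
  have hcomm := veeGroup_commute_or p q
  have hdich := D.idempotent_mul_mul_eq_zero
  have hT := transposition_veeGroup p q
  -- Inversion on the group together with reversal of products is what exchanges the two indices.
  have hTm : ∀ u i j, ((m i : (Cl p q)ˣ)⁻¹).1 * transposition p q u * (m j : (Cl p q)ˣ).1 =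
      transposition p q (((m j : (Cl p q)ˣ)⁻¹).1 * u * (m i : (Cl p q)ˣ).1) := fun u i j => by
    rw [transposition_mul, transposition_mul, hT _ (m i).2, hT _ (inv_mem (m j).2), inv_inv,
      mul_assoc]
  -- The residues 1 and 5 in the case lists are vacuous; they must be removed because the values of
  -- p + q - 2k used below fail there.
  have hexp : ((p : ℤ) - q) % 8 ≠ 1 ∧ ((p : ℤ) - q) % 8 ≠ 5 := by
    rw [Int.ModEq] at hsimple
    constructor <;> omega
  refine ⟨hN, spinorBasis hf (fun i => (m i : (Cl p q)ˣ)) horth hsum,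
    spinorBasis_apply hf _ horth hsum, fun hmod => ?_, fun hmod => ?_, fun hmod => ?_⟩
  · have hr : p + q = 2 * spinorExponent p q + 0 := by
      unfold spinorExponent radonHurwitz
      rcases hmod with h | h | h <;> split_ifs <;> omega
    have hle : commutant (veeGroup p q) D.idempotent ≤ signCommutant (veeGroup p q) D.idempotent :=
      fun g hg => by
        obtain ⟨i, hi⟩ := exists_mem_coset_of_card_le (signCommutant_le _ _) (fun _ : Fin 1 => 1)
          (fun _ => Subgroup.one_mem _) (fun i j _ => Subsingleton.elim i j)
          (D.card_commutant_le hm hpq hsimple hr) hg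
        simpa using hi
    obtain ⟨φ⟩ := nonempty_corner_algEquiv_real hf h0 hspan hdich hle
    refine ⟨⟨φ⟩, fun u => ?_⟩
    ext1 i j
    rw [Matrix.transpose_apply, spinorMatrix_spinorBasis, spinorMatrix_spinorBasis, hTm]
    apply φ.injective
    -- Conjugation on ℝ is trivial, and the condition on square roots of -1 is vacuous.
    have := map_toCorner_eq_star hf (fun r x => star_smul r x) (fun x : ℝ => fun h => by nlinarith [mul_self_nonneg x]) hspan
      hdich hsq (fun g hg _ => hle hg) (transposition p q) hT φ.toAlgHom
    exact this _
  · have hr : p + q = 2 * spinorExponent p q + 1 := by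
      unfold spinorExponent radonHurwitz
      rcases hmod with h | h <;> split_ifs <;> omega
    have hodd : Odd (p + q) := ⟨_, hr⟩
    have hω2 : monomial p q Finset.univ * monomial p q Finset.univ = -1 :=
      (monomial_sq_eq_or p q _).resolve_left fun h => by
        rw [monomial_sq_eq_one_iff, sqSign_univ hpq hsimple hodd] at h
        norm_num at h
    have hcen := monomial_univ_central (p := p) (q := q) hodd
    have hcard := D.card_commutant_le hm hpq hsimple hr
    refine ⟨nonempty_corner_algEquiv_complex hf h0 hsq (monomial_mem p q _) hω2 hcen hcard hspan
      hdich, fun φ u => ?_⟩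
    ext1 i j
    rw [Matrix.conjTranspose_apply, Matrix.map_apply, Matrix.map_apply, spinorMatrix_spinorBasis,
      spinorMatrix_spinorBasis, hTm]
    exact map_toCorner_eq_star hf (fun r x => by simp) complex_star_eq_neg_of_sq_eq_neg_one hspan hdich hsq
      (fun g hg h => mem_signCommutant_of_central h0 hsq (monomial_mem p q _) hω2 hcen hcard hg h)
      (transposition p q) hT φ.toAlgHom _
  · have hr : p + q = 2 * spinorExponent p q + 2 := by
      unfold spinorExponent radonHurwitz
      rcases hmod with h | h | h <;> split_ifs <;> omega
    have hcard := D.card_commutant_le hm hpq hsimple hr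
    have hlt := D.two_mul_card_sq_lt hm hpq hsimple (by omega)
    refine ⟨nonempty_corner_algEquiv_quaternion hf h0 hsq hcard hlt hcomm (neg_one_mem p q) hspan
      hdich, fun φ u => ?_⟩
    ext1 i j
    rw [Matrix.conjTranspose_apply, Matrix.map_apply, Matrix.map_apply, spinorMatrix_spinorBasis,
      spinorMatrix_spinorBasis, hTm]
    exact map_toCorner_eq_star hf Quaternion.star_smul quaternion_star_eq_neg_of_sq_eq_neg_one hspan hdich hsq
      (fun g hg h => mem_signCommutant_of_card_lt h0 hsq hcard hlt hcomm hg h)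
      (transposition p q) hT φ.toAlgHom _
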